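/- Let $q:\mathbb R\to\mathbb R$ be integrable over $\mathbb R$. Consider the Schrödinger operator $H=-\frac{d^2}{dx^2}+x^2+q(x)$ on $L^2(\mathbb R)$: an eigenfunction for $\mu\in\mathbb R$ is a nonzero $u\in L^2(\mathbb R)$, differentiable with locally absolutely continuous derivative, with $-u''+(x^2+q)u=\mu u$ almost everywhere. Let $H_j$ be the Hermite polynomials orthogonal for the weight $e^{-x^2}$ ($H_0=1$, $H_{j+1}=2xH_j-H_j'$), and let $$q_j=\frac{1}{\sqrt{\pi}\,2^j\,j!}\int_{\mathbb R}e^{-x^2}q(x)H_j(x)\,dx\qquad(j=0,1,2,\dots)$$ be the Hermite coefficients of $q$ (the coefficients in $q=\sum_j q_jH_j$ when $q\in L^2(\mathbb R,e^{-x^2}dx)$). Let $\lambda_k^0=2k+1$ denote the eigenvalues of the harmonic oscillator $-\frac{d^2}{dx^2}+x^2$. Then the eigenvalues of $H$, repeated according to multiplicity, form a sequence $\lambda_0\le\lambda_1\le\lambda_2\le\dots\to\infty$, and for every integer $n\ge 0$ $$\sum_{k=0}^n\left[\lambda_k-\lambda_k^0-\frac{1}{\pi\sqrt{\lambda_k^0}}\int_{\mathbb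 R}q(x)\,dx\right]\le\sum_{k=0}^n\left[\frac{2^k(2k)!}{k!}\binom{n+1}{k+1}q_{2k}-\frac{1}{\pi\sqrt{\lambda_k^0}}\int_{\mathbb R}q(x)\,dx\right].$$ -/

import Mathlib

open MeasureTheory Filter Polynomial
open scoped Nat

/-- The (physicists') Hermite polynomials `H_k`, orthogonal for the weight `e^{-x²}`:
`H_0 = 1` and `H_{k+1} = 2 x H_k - H_k'`. -/
noncomputable def hermiteH : ℕ → ℝ[X]
  | 0 => 1
  | k + 1 => 2 * X * hermiteH k - derivative (hermiteH k)

/-- The `j`-th Hermite coefficient `q_j` in the expansion `q = ∑ q_j H_j` with respect to the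
weight `e^{-x²}`; the normalising constant is `∫ e^{-x²} H_j(x)² dx = √π 2^j j!`. -/
noncomputable def hermiteCoeff (q : ℝ → ℝ) (j : ℕ) : ℝ :=
  (∫ x : ℝ, Real.exp (-x ^ 2) * q x * (hermiteH j).eval x) / (√Real.pi * 2 ^ j * (j ! : ℝ))

/-- The eigenspace, for the value `μ`, of the Schrödinger operator `-d²/dx² + V` on `L²(ℝ)`:
all square integrable `u`, differentiable with locally absolutely continuous derivative,
such that `-u'' + V u = μ u` almost everywhere. (Then `-u'' + V u` is again in `L²(ℝ)`, so `u` is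
in the maximal domain of the operator. Two members that agree almost everywhere are equal, being
continuous, so that this is the eigenspace inside `L²(ℝ)`.) -/
noncomputable def schrodingerEigenspace (V : ℝ → ℝ) (μ : ℝ) : Submodule ℝ (ℝ → ℝ) where
  carrier := {u | Differentiable ℝ u ∧
    (∀ a b : ℝ, AbsolutelyContinuousOnInterval (deriv u) a b) ∧
    MemLp u 2 volume ∧
    ∀ᵐ x : ℝ, -deriv (deriv u) x + V x * u x = μ * u x}
  zero_mem' := by
    have h0 : deriv (0 : ℝ → ℝ) = 0 := by ext x; simp
    refine ⟨differentiable_const 0, fun a b => ?_, MemLp.zero, ?_⟩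
    · rw [h0]
      exact (contDiffOn_const (c := (0 : ℝ))).absolutelyContinuousOnInterval
    · rw [h0, h0]
      simp
  add_mem' := by
    rintro u v ⟨hu, hu', hu2, hue⟩ ⟨hv, hv', hv2, hve⟩
    have hd : deriv (u + v) = deriv u + deriv v := by
      ext x; exact deriv_add (hu x) (hv x)
    have key : ∀ w : ℝ → ℝ, (∀ a b : ℝ, AbsolutelyContinuousOnInterval w a b) →
        ∀ᵐ x : ℝ, DifferentiableAt ℝ w x := by
      intro w hw
      have h1 : ∀ n : ℕ, ∀ᵐ x : ℝ, x ∈ Set.uIcc (-(n : ℝ)) n → DifferentiableAt ℝ w x :=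
        fun n => (hw _ _).ae_differentiableAt
      filter_upwards [ae_all_iff.2 h1] with x hx
      obtain ⟨n, hn⟩ := exists_nat_ge |x|
      refine hx n ?_
      rw [Set.uIcc_of_le (by linarith [abs_nonneg x])]
      exact ⟨by linarith [neg_abs_le x], by linarith [le_abs_self x]⟩
    refine ⟨hu.add hv, fun a b => ?_, hu2.add hv2, ?_⟩
    · rw [hd]; exact (hu' a b).add (hv' a b)
    · filter_upwards [key _ hu', key _ hv', hue, hve] with x h1 h2 h3 h4
      rw [hd, deriv_add h1 h2, Pi.add_apply]
      linear_combination h3 + h4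
  smul_mem' := by
    rintro c u ⟨hu, hu', hu2, hue⟩
    have hd : ∀ w : ℝ → ℝ, deriv (c • w) = c • deriv w := by
      intro w; ext x; exact deriv_const_smul_field c w
    refine ⟨hu.const_smul c, fun a b => ?_, hu2.const_smul c, ?_⟩
    · rw [hd]; exact (hu' a b).const_smul c
    · filter_upwards [hue] with x hx
      rw [hd, hd]
      simp only [Pi.smul_apply, smul_eq_mul]
      linear_combination c * hx

/-- `l 0 ≤ l 1 ≤ l 2 ≤ …` is the list of all eigenvalues of `-d²/dx² + V` on `L²(ℝ)`, each
repeated according to its multiplicity: every real `μ` occurs exactly as many times as the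
dimension of its eigenspace. -/
structure IsEigenvalueSequence (V : ℝ → ℝ) (l : ℕ → ℝ) : Prop where
  monotone : Monotone l
  multiplicity : ∀ μ : ℝ,
    Cardinal.mk {k : ℕ // l k = μ} = Module.rank ℝ (schrodingerEigenspace V μ)

/-- The eigenvalues `λ_k⁰ = 2k + 1` of the quantum harmonic oscillator `-d²/dx² + x²`. -/
def harmonicEigenvalue (k : ℕ) : ℝ := 2 * k + 1

/-! The terms with the integral of `q` are the same on both sides and cancel. What remains is a
trial-function bound: the sum of the lowest `n + 1` eigenvalues is at most the trace of the
quadratic form of `H` over the normalized Hermite functions `h_0, …, h_n`, where each diagonal value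
is `2k + 1 + ∫ q h_k²`.

The variational half is `sum_eigenvalues_le_trace`. In an orthonormal eigenbasis `b_j`, the trace
dominates `∑ λ_j p_j` with weights `p_j = ∑_k ⟪b_j, h_k⟫²`. Bessel gives `p_j ≤ 1`, Parseval gives
total mass `n + 1`, and such a weighting is cheapest when it fills the lowest `n + 1` levels
(`sum_range_le_of_weights`).

The algebraic half is `sum_hermiteH_sq_div`. Up to the factor `e^{-x²}/√π`, the sum of the `h_k²` is
`∑ H_m²/(2^m m!)`, which the linearization formula and the hockey-stick identity turn into `∑
binom(n+1, j+1) H_{2j}/(2^j j!)`. Integrating against `q` and inserting the norm of `H_{2j}` gives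
the factor `2^j (2j)!/j!`.

Since `q` is only integrable, `H` is handled through its form on the functions `u` with `u'` and
`√(1 + x²) u` in `L²`. The Sobolev inequality `fn_sq_le` bounds `u²` pointwise with an arbitrarily
small multiple of `‖u'‖²`, so the form is coercive after a shift. The domain embeds compactly into
`L²` (`isCompactOperator_emb`), so the solution operator is compact and self-adjoint, and the
spectral theorem supplies the eigenbasis.

Finally the form eigenvectors must be matched with the classical eigenfunctions of the statement
(`formEigenspaceEquivSchrodinger`). Weak solutions are classical by the du Bois-Reymond lemma;
conversely, a cutoff estimate shows that a square integrable classical solution has finite energy.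
-/

/-! ### Enumerating a discrete family of reals. -/

section Enumeration

/-- A family of reals with finite sublevel sets, indexed by an infinite type, can be enumerated in
increasing order. -/
theorem exists_equiv_monotone_tendsto {I : Type*} [Infinite I] (f : I → ℝ)
    (hf : ∀ M : ℝ, {i | f i ≤ M}.Finite) :
    ∃ σ : ℕ ≃ I, Monotone (f ∘ σ) ∧ Tendsto (f ∘ σ) atTop atTop := by
  classical
  have hc : Countable I := by
    have : (Set.univ : Set I) = ⋃ n : ℕ, {i | f i ≤ n} := by
      ext i
      simpa using exists_nat_ge (f i)
    rw [← Set.countable_univ_iff, this]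
    exact Set.countable_iUnion fun n => (hf n).countable
  obtain ⟨e, he⟩ := exists_injective_nat I
  -- The injection into `ℕ` breaks ties between equal values, so the lexicographic order is linear
  -- on `I` and its initial segments are finite.
  let g : I → ℝ ×ₗ ℕ := fun i => toLex (f i, e i)
  have hg : Function.Injective g := fun i j hij => he (by
    have := congrArg (fun z => (ofLex z).2) hij
    simpa [g] using this)
  let _ : LinearOrder I := LinearOrder.lift' g hg
  have hle : ∀ i j : I, i ≤ j → f i ≤ f j := by
    intro i j hij
    have h : g i ≤ g j := hij
    rw [Prod.Lex.le_iff] at h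
    rcases h with h | h
    · exact le_of_lt h
    · exact h.1.le
  have hfin : ∀ i : I, (Set.Iic i).Finite := fun i =>
    (hf (f i)).subset fun j hj => hle j i hj
  let _ : LocallyFiniteOrder I := LocallyFiniteOrder.ofFiniteIcc fun a b =>
    (hfin b).subset Set.Icc_subset_Iic_self
  have hne : Nonempty I := inferInstance
  obtain ⟨i₀, hi₀⟩ : ∃ i₀ : I, ∀ j, i₀ ≤ j := by
    obtain ⟨a⟩ := hne
    obtain ⟨m, hm, hmin⟩ := Set.exists_min_image (Set.Iic a) id (hfin a) ⟨a, Set.mem_Iic.2 le_rfl⟩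
    refine ⟨m, fun j => ?_⟩
    rcases le_total j a with h | h
    · exact hmin j h
    · exact (show m ≤ a from hm).trans h
  let _ : OrderBot I := { bot := i₀, bot_le := hi₀ }
  have : NoMaxOrder I := ⟨fun a => by
    by_contra! h
    exact Set.infinite_univ ((hfin a).subset fun j _ => h j)⟩
  let _ : SuccOrder I := LinearLocallyFiniteOrder.succOrder I
  let _ : PredOrder I := LinearLocallyFiniteOrder.predOrder I
  -- A linear order that is locally finite, with a bottom and no maximum, is isomorphic to `ℕ`.
  let σ : I ≃o ℕ := orderIsoNatOfLinearSuccPredArch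
  have hmono : Monotone (f ∘ σ.symm.toEquiv) := fun a b hab => hle _ _ (σ.symm.monotone hab)
  refine ⟨σ.symm.toEquiv, hmono, tendsto_atTop_atTop_of_monotone hmono fun M => ?_⟩
  by_contra! h
  refine Set.infinite_univ ((hf M).subset fun i _ => ?_)
  have := (h (σ i)).le
  simpa using this

end Enumeration

/-! ### Spectral theory of a coercive form with compact embedding. -/

section AbstractSpectral

open scoped InnerProductSpace

variable {E L : Type*} [NormedAddCommGroup E] [InnerProductSpace ℝ E]
  [NormedAddCommGroup L] [InnerProductSpace ℝ L]

/-- The generalized eigenspace `{e | B(e, ·) = μ ⟪J e, J ·⟫}` of a bilinear form `B` relative to the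
embedding `J` of its domain. -/
def formEigenspace (J : E →L[ℝ] L) (B : E →L[ℝ] E →L[ℝ] ℝ) (μ : ℝ) : Submodule ℝ E where
  carrier := {e | ∀ f, B e f = μ * ⟪J e, J f⟫_ℝ}
  zero_mem' := by simp
  add_mem' := by
    intro a b ha hb f
    simp only [map_add, add_apply, inner_add_left, ha f, hb f]
    ring
  smul_mem' := by
    intro c a ha f
    simp only [map_smul, smul_apply, inner_smul_left, ha f, smul_eq_mul]
    simp
    ring

variable {J : E →L[ℝ] L} {B : E →L[ℝ] E →L[ℝ] ℝ}

theorem mem_formEigenspace {μ : ℝ} {e : E} :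
    e ∈ formEigenspace J B μ ↔ ∀ f, B e f = μ * ⟪J e, J f⟫_ℝ := Iff.rfl

/-- If `J e = 0`, the eigenvalue equation tested with `e` itself gives `B e e = 0`, and coercivity
forces `e = 0`. `J` itself need not be injective. -/
theorem formEigenspace_injOn (hB : IsCoercive B) {μ : ℝ} {e : E}
    (he : e ∈ formEigenspace J B μ) (h : J e = 0) : e = 0 := by
  obtain ⟨C, hC, hCB⟩ := hB
  have h1 := hCB e
  rw [he e, h] at h1
  simp only [inner_zero_left, mul_zero] at h1
  by_contra hne
  have : 0 < ‖e‖ := norm_pos_iff.2 hne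
  have : 0 < C * ‖e‖ * ‖e‖ := by positivity
  linarith

/-- The image of `formEigenspace J B μ` in the ambient Hilbert space. -/
def ambientEigenspace (J : E →L[ℝ] L) (B : E →L[ℝ] E →L[ℝ] ℝ) (μ : ℝ) : Submodule ℝ L :=
  (formEigenspace J B μ).map (J : E →ₗ[ℝ] L)

theorem mem_ambientEigenspace {μ : ℝ} {x : L} :
    x ∈ ambientEigenspace J B μ ↔ ∃ e ∈ formEigenspace J B μ, J e = x := by
  simp [ambientEigenspace, Submodule.mem_map]

/-- The two models of an eigenspace are isomorphic. -/
noncomputable def formEigenspaceEquiv (hB : IsCoercive B) (μ : ℝ) :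
    formEigenspace J B μ ≃ₗ[ℝ] ambientEigenspace J B μ :=
  LinearEquiv.ofBijective ((J : E →ₗ[ℝ] L).submoduleMap (formEigenspace J B μ)) (by
    refine ⟨?_, LinearMap.submoduleMap_surjective _ _⟩
    rw [← LinearMap.ker_eq_bot, LinearMap.ker_eq_bot']
    intro e he
    apply Subtype.ext
    exact formEigenspace_injOn hB e.2 (congrArg Subtype.val he))

theorem rank_ambientEigenspace {E L : Type} [NormedAddCommGroup E] [InnerProductSpace ℝ E]
    [NormedAddCommGroup L] [InnerProductSpace ℝ L] {J : E →L[ℝ] L} {B : E →L[ℝ] E →L[ℝ] ℝ}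
    (hB : IsCoercive B) (μ : ℝ) :
    Module.rank ℝ (ambientEigenspace J B μ) = Module.rank ℝ (formEigenspace J B μ) :=
  (formEigenspaceEquiv hB μ).rank_eq.symm

/-- Evaluating `B e f` through either eigenvalue equation gives `(μ - ν) ⟪J e, J f⟫ = 0`. -/
theorem orthogonalFamily_ambientEigenspace (hs : ∀ e f, B e f = B f e) :
    OrthogonalFamily ℝ (fun μ => ambientEigenspace J B μ)
      (fun μ => (ambientEigenspace J B μ).subtypeₗᵢ) := by
  intro μ ν hμν x y
  obtain ⟨e, he, hex⟩ := mem_ambientEigenspace.1 x.2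
  obtain ⟨f, hf, hfy⟩ := mem_ambientEigenspace.1 y.2
  have h1 := he f
  have h2 := hf e
  rw [hs f e, h1, real_inner_comm (J e), hex, hfy] at h2
  have : (μ - ν) * ⟪(x : L), (y : L)⟫_ℝ = 0 := by linarith
  rcases mul_eq_zero.1 this with h | h
  · exact absurd (sub_eq_zero.1 h) hμν
  · exact h

/-- For an orthonormal family of eigenvectors, only finitely many eigenvalues lie below any
bound. -/
theorem finite_setOf_eigenvalue_le (hJ : IsCompactOperator J) (hB : IsCoercive B)
    {I : Type*} {b : I → L} (hb : Orthonormal ℝ b) {f : I → ℝ}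
    (hbf : ∀ i, b i ∈ ambientEigenspace J B (f i)) (M : ℝ) : {i | f i ≤ M}.Finite := by
  by_contra hinf
  have hinf : {i | f i ≤ M}.Infinite := hinf
  let ι := hinf.natEmbedding
  choose e he hex using fun n : ℕ => mem_ambientEigenspace.1 (hbf (ι n))
  obtain ⟨C, hC, hCB⟩ := hB
  -- Coercivity gives `C ‖e n‖² ≤ B (e n) (e n)`, which is the eigenvalue of `e n` because `J (e n)`
  -- is a unit vector, hence at most `M`.
  have hbound : ∀ n, e n ∈ Metric.closedBall (0 : E) (√(M / C)) := by
    intro n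
    rw [mem_closedBall_zero_iff]
    apply Real.le_sqrt_of_sq_le
    have h1 := hCB (e n)
    rw [he n, hex n, real_inner_self_eq_norm_sq, hb.1] at h1
    have h2 : f (ι n) ≤ M := (ι n).2
    rw [le_div_iff₀ hC]
    nlinarith
  obtain ⟨K, hK, hKs⟩ := hJ.image_closedBall_subset_compact (√(M / C))
  have hmem : ∀ n, b (ι n) ∈ K := fun n => hKs ⟨e n, hbound n, hex n⟩
  obtain ⟨a, -, u, hu, hlim⟩ := hK.tendsto_subseq hmem
  have hcau := hlim.cauchySeq
  rw [Metric.cauchySeq_iff'] at hcau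
  obtain ⟨N, hN⟩ := hcau 1 one_pos
  have h1 := hN (N + 1) (Nat.le_succ N)
  have hne : (ι (u (N + 1)) : I) ≠ ι (u N) := by
    intro h
    have := hu.injective (ι.injective (Subtype.ext h))
    omega
  -- Distinct orthonormal vectors are at distance `√2`, so no subsequence is Cauchy.
  have h2 : dist (b (ι (u (N + 1)))) (b (ι (u N))) ^ 2 = 2 := by
    rw [dist_eq_norm, norm_sub_sq_real, hb.1, hb.1, hb.2 hne]
    norm_num
  have h3 : dist (b (ι (u (N + 1)))) (b (ι (u N))) < 1 := h1
  nlinarith [dist_nonneg (x := b (ι (u (N + 1)))) (y := b (ι (u N)))]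

/-- The increasing rearrangement inequality: weights `p j ∈ [0, 1]` of total mass `n + 1`, tested
against a monotone sequence, give at least the sum of the first `n + 1` terms. -/
theorem sum_range_le_of_weights {l p : ℕ → ℝ} (hl : Monotone l) (h0 : ∀ j, 0 ≤ p j)
    (h1 : ∀ j, p j ≤ 1) (n : ℕ) (hp : HasSum p (n + 1)) {S : ℝ}
    (hS : ∀ N, ∑ j ∈ Finset.range N, l j * p j ≤ S) :
    ∑ j ∈ Finset.range (n + 1), l j ≤ S := by
  -- Every term is compared with the threshold `l n`: `(l j - l n) (p j - 1) ≥ 0` for `j ≤ n` and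
  -- `(l j - l n) p j ≥ 0` beyond. The correction `l n * (mass - (n + 1))` vanishes as `m → ∞`.
  have key : ∀ m, ∑ j ∈ Finset.range (n + 1), l j
      + l n * (∑ j ∈ Finset.range (n + 1 + m), p j - (n + 1)) ≤ S := by
    intro m
    refine le_trans ?_ (hS (n + 1 + m))
    rw [Finset.sum_range_add p, Finset.sum_range_add (fun j => l j * p j)]
    have hA : ∑ j ∈ Finset.range (n + 1), l j + l n * (∑ j ∈ Finset.range (n + 1), p j - (n + 1))
        ≤ ∑ j ∈ Finset.range (n + 1), l j * p j := by
      have : l n * (∑ j ∈ Finset.range (n + 1), p j - (n + 1))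
          = ∑ j ∈ Finset.range (n + 1), l n * (p j - 1) := by
        rw [← Finset.mul_sum, Finset.sum_sub_distrib]
        simp
      rw [this, ← Finset.sum_add_distrib]
      refine Finset.sum_le_sum fun j hj => ?_
      have : l j ≤ l n := hl (by simp at hj; omega)
      nlinarith [h1 j]
    have hB : l n * ∑ j ∈ Finset.range m, p (n + 1 + j)
        ≤ ∑ j ∈ Finset.range m, l (n + 1 + j) * p (n + 1 + j) := by
      rw [Finset.mul_sum]
      exact Finset.sum_le_sum fun j _ =>
        mul_le_mul_of_nonneg_right (hl (by omega)) (h0 _)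
    linarith
  have hlim : Tendsto (fun m => ∑ j ∈ Finset.range (n + 1), l j
      + l n * (∑ j ∈ Finset.range (n + 1 + m), p j - (n + 1))) atTop
      (nhds (∑ j ∈ Finset.range (n + 1), l j + l n * ((n + 1 : ℝ) - (n + 1)))) := by
    refine tendsto_const_nhds.add (tendsto_const_nhds.mul (Tendsto.sub_const ?_ _))
    exact hp.tendsto_sum_nat.comp (tendsto_add_atTop_nat (n + 1) |>.congr fun m => by ring)
  simpa using le_of_tendsto' hlim key

variable [CompleteSpace E] [CompleteSpace L]

/-- The eigenvectors of a coercive symmetric form with compactly embedded dense domain span a dense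
subspace. -/
theorem orthogonal_iSup_ambientEigenspace (hJ : IsCompactOperator J) (hB : IsCoercive B)
    (hs : ∀ e f, B e f = B f e) (hd : ∀ x : L, (∀ e, ⟪x, J e⟫_ℝ = 0) → x = 0) :
    (⨆ μ, ambientEigenspace J B μ)ᗮ = ⊥ ∧
      ∀ μ, FiniteDimensional ℝ (ambientEigenspace J B μ) := by
  let P := hB.continuousLinearEquivOfBilin
  -- The Lax–Milgram solution operator, `B (S x) f = ⟪x, J f⟫`. Then `J ∘L S` is compact and
  -- symmetric, and its eigenvalues are the reciprocals of those of the form.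
  let S : L →L[ℝ] E := (P.symm : E →L[ℝ] E) ∘L (ContinuousLinearMap.adjoint J)
  have hS : ∀ x f, B (S x) f = ⟪x, J f⟫_ℝ := by
    intro x f
    rw [← hB.continuousLinearEquivOfBilin_apply]
    simp only [S, P, ContinuousLinearMap.comp_apply, ContinuousLinearEquiv.coe_coe,
      ContinuousLinearEquiv.apply_symm_apply]
    exact ContinuousLinearMap.adjoint_inner_left J f x
  have huniq : ∀ e f : E, (∀ g, B e g = B f g) → e = f := by
    intro e f h
    obtain ⟨C, hC, hCB⟩ := hB
    have h1 := hCB (e - f)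
    rw [map_sub B, sub_apply, h, sub_self] at h1
    by_contra hne
    have : 0 < ‖e - f‖ := norm_pos_iff.2 (sub_ne_zero.2 hne)
    have : 0 < C * ‖e - f‖ * ‖e - f‖ := by positivity
    linarith
  let R : L →L[ℝ] L := J ∘L S
  have hR : IsCompactOperator R := hJ.comp_clm S
  have hRs : R.IsSymmetric := by
    intro x y
    change ⟪J (S x), y⟫_ℝ = ⟪x, J (S y)⟫_ℝ
    rw [real_inner_comm, ← hS, ← hS, hs]
  have hR0 : ∀ x, R x = 0 → x = 0 := by
    intro x hx
    have h0 : S x = 0 := by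
      apply huniq
      obtain ⟨C, hC, hCB⟩ := hB
      have h1 := hCB (S x)
      rw [hS] at h1
      have h2 : J (S x) = 0 := hx
      rw [h2, inner_zero_right] at h1
      have : S x = 0 := by
        by_contra hne
        have : 0 < ‖S x‖ := norm_pos_iff.2 hne
        have : 0 < C * ‖S x‖ * ‖S x‖ := by positivity
        linarith
      intro g
      rw [this]
    refine hd x fun e => ?_
    rw [← hS, h0]
    simp
  have h1 : ∀ ν, Module.End.eigenspace (R : Module.End ℝ L) ν ≤ ambientEigenspace J B ν⁻¹ := by
    intro ν x hx
    rw [Module.End.mem_eigenspace_iff] at hx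
    have hx : J (S x) = ν • x := hx
    -- For `ν = 0` the index `ν⁻¹` is the default value `0`; the inclusion still holds because
    -- density of the range of `J` makes `R` injective.
    rcases eq_or_ne ν 0 with h | h
    · subst h
      rw [hR0 x (by rw [zero_smul] at hx; exact hx)]
      exact Submodule.zero_mem _
    refine mem_ambientEigenspace.2 ⟨ν⁻¹ • S x, fun f => ?_, ?_⟩
    · rw [map_smul, map_smul, hx, smul_smul, inv_mul_cancel₀ h, one_smul,
        smul_apply, hS, smul_eq_mul]
    · rw [map_smul, hx, smul_smul, inv_mul_cancel₀ h, one_smul]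
  have h2 : ∀ μ, μ ≠ 0 →
      ambientEigenspace J B μ ≤ Module.End.eigenspace (R : Module.End ℝ L) μ⁻¹ := by
    intro μ hμ x hx
    obtain ⟨e, he, rfl⟩ := mem_ambientEigenspace.1 hx
    rw [Module.End.mem_eigenspace_iff]
    have : μ • S (J e) = e := by
      apply huniq
      intro g
      rw [map_smul, smul_apply, hS, he g, smul_eq_mul]
    change J (S (J e)) = μ⁻¹ • J e
    conv_rhs => rw [← this]
    rw [map_smul, smul_smul, inv_mul_cancel₀ hμ, one_smul]
  constructor
  · rw [eq_bot_iff, ← ContinuousLinearMap.orthogonalComplement_iSup_eigenspaces_eq_bot hR hRs]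
    apply Submodule.orthogonal_le
    exact iSup_le fun ν => (h1 ν).trans (le_iSup (fun μ => ambientEigenspace J B μ) ν⁻¹)
  · intro μ
    rcases eq_or_ne μ 0 with rfl | hμ
    · have : ambientEigenspace J B 0 = ⊥ := by
        rw [eq_bot_iff]
        intro x hx
        obtain ⟨e, he, rfl⟩ := mem_ambientEigenspace.1 hx
        have : e = 0 := huniq _ _ fun g => by rw [he g]; simp
        rw [this]
        simp
      rw [this]
      infer_instance
    · have := ContinuousLinearMap.finite_dimensional_eigenspace hR μ⁻¹ (inv_ne_zero hμ)
      exact Submodule.finiteDimensional_of_le (h2 μ hμ)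

/-- An orthonormal basis of each eigenspace gives an orthonormal family with trivial orthogonal
complement. -/
theorem orthonormal_sigma_eigenbasis (hJ : IsCompactOperator J) (hB : IsCoercive B)
    (hs : ∀ e f, B e f = B f e) (hd : ∀ x : L, (∀ e, ⟪x, J e⟫_ℝ = 0) → x = 0)
    {α : ℝ → Type*} [∀ μ, Fintype (α μ)]
    (b : ∀ μ, OrthonormalBasis (α μ) ℝ (ambientEigenspace J B μ)) :
    Orthonormal ℝ (fun i : Σ μ, α μ => (b i.1 i.2 : L)) ∧
      (Submodule.span ℝ (Set.range fun i : Σ μ, α μ => (b i.1 i.2 : L)))ᗮ = ⊥ := by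
  refine ⟨(orthogonalFamily_ambientEigenspace hs).orthonormal_sigma_orthonormal
    (fun μ => (b μ).orthonormal), ?_⟩
  rw [eq_bot_iff, ← (orthogonal_iSup_ambientEigenspace hJ hB hs hd).1]
  apply Submodule.orthogonal_le
  refine iSup_le fun μ x hx => ?_
  have h1 := (b μ).sum_repr ⟨x, hx⟩
  have h2 := congrArg (Subtype.val) h1
  simp only [Submodule.coe_sum, Submodule.coe_smul] at h2
  rw [← h2]
  exact Submodule.sum_mem _ fun i _ => Submodule.smul_mem _ _ (Submodule.subset_span ⟨⟨μ, i⟩, rfl⟩)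

end AbstractSpectral

/-! ### Eigenvalue sequences and the trace inequality. -/

section AbstractMinMax

open scoped InnerProductSpace

variable {E L : Type} [NormedAddCommGroup E] [InnerProductSpace ℝ E] [CompleteSpace E]
  [NormedAddCommGroup L] [InnerProductSpace ℝ L] [CompleteSpace L]
  {J : E →L[ℝ] L} {B : E →L[ℝ] E →L[ℝ] ℝ}

/-- The eigenvalues of a coercive symmetric form with compactly embedded dense domain can be
enumerated, with multiplicity, by a sequence increasing to infinity. -/
theorem exists_form_eigenvalue_sequence (hJ : IsCompactOperator J) (hB : IsCoercive B)
    (hs : ∀ e f, B e f = B f e) (hd : ∀ x : L, (∀ e, ⟪x, J e⟫_ℝ = 0) → x = 0)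
    (hL : ¬ FiniteDimensional ℝ L) :
    ∃ l : ℕ → ℝ, Monotone l ∧ Tendsto l atTop atTop ∧
      ∀ μ, Cardinal.mk {k : ℕ // l k = μ} = Module.rank ℝ (formEigenspace J B μ) := by
  have hfd := (orthogonal_iSup_ambientEigenspace hJ hB hs hd).2
  obtain ⟨hon, hspan⟩ := orthonormal_sigma_eigenbasis hJ hB hs hd
    (fun μ => stdOrthonormalBasis ℝ (ambientEigenspace J B μ))
  let I := Σ μ, Fin (Module.finrank ℝ (ambientEigenspace J B μ))
  have hinf : Infinite I := by
    by_contra h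
    rw [not_infinite_iff_finite] at h
    apply hL
    have h1 : FiniteDimensional ℝ (Submodule.span ℝ (Set.range fun i : I =>
        (stdOrthonormalBasis ℝ (ambientEigenspace J B i.1) i.2 : L))) :=
      FiniteDimensional.span_of_finite ℝ (Set.finite_range _)
    rw [Submodule.orthogonal_eq_bot_iff] at hspan
    rw [hspan] at h1
    exact Module.finite_def.2 (Submodule.fg_top _ |>.1 (Module.finite_def.1 h1))
  obtain ⟨σ, hm, ht⟩ := exists_equiv_monotone_tendsto (fun i : I => i.1)
    (finite_setOf_eigenvalue_le hJ hB hon (fun i => Subtype.mem _))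
  refine ⟨_, hm, ht, fun μ => ?_⟩
  rw [← rank_ambientEigenspace hB, ← Module.finrank_eq_rank]
  have e1 : {k : ℕ // ((fun i : I => i.1) ∘ σ) k = μ} ≃ {i : I // i.1 = μ} :=
    σ.subtypeEquiv fun k => Iff.rfl
  have e2 := Equiv.sigmaSubtype
    (β := fun μ : ℝ => Fin (Module.finrank ℝ (ambientEigenspace J B μ))) μ
  rw [Cardinal.mk_congr (e1.trans e2)]
  simp

/-- The sum of the first `n + 1` eigenvalues is at most the trace of the form over any `n + 1`
orthonormal trial vectors. -/
theorem sum_eigenvalues_le_trace (hJ : IsCompactOperator J) (hB : IsCoercive B)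
    (hs : ∀ e f, B e f = B f e) (hd : ∀ x : L, (∀ e, ⟪x, J e⟫_ℝ = 0) → x = 0)
    {l : ℕ → ℝ} (hl : Monotone l)
    (hm : ∀ μ, Cardinal.mk {k : ℕ // l k = μ} = Module.rank ℝ (formEigenspace J B μ))
    {u : ℕ → E} (hu : Orthonormal ℝ (fun k => J (u k))) (n : ℕ) :
    ∑ k ∈ Finset.range (n + 1), l k ≤ ∑ k ∈ Finset.range (n + 1), B (u k) (u k) := by
  have hfd := (orthogonal_iSup_ambientEigenspace hJ hB hs hd).2
  have hfin : ∀ μ, Finite {k : ℕ // l k = μ} := by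
    intro μ
    rw [← Cardinal.mk_lt_aleph0_iff, hm, ← rank_ambientEigenspace hB]
    exact Module.rank_lt_aleph0 ℝ _
  let _ : ∀ μ, Fintype {k : ℕ // l k = μ} := fun μ => Fintype.ofFinite _
  have hcard : ∀ μ, Fintype.card (Fin (Module.finrank ℝ (ambientEigenspace J B μ)))
      = Fintype.card {k : ℕ // l k = μ} := by
    intro μ
    have h := hm μ
    rw [← rank_ambientEigenspace hB, ← Module.finrank_eq_rank, Cardinal.mk_fintype] at h
    simpa using (Nat.cast_injective h).symm
  -- Each eigenbasis is indexed by the fibre of `l` over its eigenvalue. The disjoint union of the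
  -- fibres is `ℕ`, so the whole eigenbasis is numbered compatibly with `l`.
  let bb : ∀ μ, OrthonormalBasis {k : ℕ // l k = μ} ℝ (ambientEigenspace J B μ) := fun μ =>
    (stdOrthonormalBasis ℝ (ambientEigenspace J B μ)).reindex (Fintype.equivOfCardEq (hcard μ))
  obtain ⟨hon, hspan⟩ := orthonormal_sigma_eigenbasis hJ hB hs hd bb
  let τ : ℕ ≃ Σ μ, {k : ℕ // l k = μ} := (Equiv.sigmaFiberEquiv l).symm
  let b : ℕ → L := fun k => (bb (τ k).1 (τ k).2 : L)
  have hb : Orthonormal ℝ b := hon.comp τ τ.injective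
  have hbspan : (Submodule.span ℝ (Set.range b))ᗮ = ⊥ := by
    have : Set.range b = Set.range fun i : Σ μ, {k : ℕ // l k = μ} => (bb i.1 i.2 : L) :=
      τ.surjective.range_comp (fun i : Σ μ, {k : ℕ // l k = μ} => (bb i.1 i.2 : L))
    rw [this]
    exact hspan
  have hbm : ∀ k, b k ∈ ambientEigenspace J B (l k) := by
    intro k
    have h1 : (τ k).1 = l k := rfl
    rw [← h1]
    exact Subtype.mem _
  choose e he hex using fun k => mem_ambientEigenspace.1 (hbm k)
  let HB : HilbertBasis ℕ ℝ L := HilbertBasis.mkOfOrthogonalEqBot hb hbspan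
  have hHB : ∀ k, HB k = b k := fun k => by simp [HB]
  have hparseval : ∀ k, HasSum (fun j => ⟪b j, J (u k)⟫_ℝ ^ 2) 1 := by
    intro k
    have h1 := HB.hasSum_inner_mul_inner (J (u k)) (J (u k))
    rw [real_inner_self_eq_norm_sq, hu.1] at h1
    have h2 : ∀ j, ⟪J (u k), HB j⟫_ℝ * ⟪HB j, J (u k)⟫_ℝ = ⟪b j, J (u k)⟫_ℝ ^ 2 := fun j => by
      rw [hHB, real_inner_comm, sq]
    simpa [h2] using h1
  -- With `s` the partial eigenvector expansion of `u k`, both `B s (u k)` and `B s s` equal the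
  -- left side, so `0 ≤ B (u k - s) (u k - s)` is the claim. Convergence of the expansion in the
  -- form norm is never needed.
  have hform : ∀ k N, ∑ j ∈ Finset.range N, l j * ⟪b j, J (u k)⟫_ℝ ^ 2 ≤ B (u k) (u k) := by
    intro k N
    let c : ℕ → ℝ := fun j => ⟪b j, J (u k)⟫_ℝ
    let s : E := ∑ j ∈ Finset.range N, c j • e j
    have hJs : J s = ∑ j ∈ Finset.range N, c j • b j := by
      simp only [s, map_sum, map_smul, hex]
    have h1 : ∀ f, B s f = ∑ j ∈ Finset.range N, c j * (l j * ⟪b j, J f⟫_ℝ) := by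
      intro f
      simp only [s, map_sum, map_smul, sum_apply,
        smul_apply, smul_eq_mul]
      exact Finset.sum_congr rfl fun j _ => by rw [he j, hex]
    have h2 : B s (u k) = ∑ j ∈ Finset.range N, l j * c j ^ 2 := by
      rw [h1]
      exact Finset.sum_congr rfl fun j _ => by ring
    have h3 : B s s = ∑ j ∈ Finset.range N, l j * c j ^ 2 := by
      rw [h1]
      refine Finset.sum_congr rfl fun j hj => ?_
      rw [hJs, hb.inner_right_sum c hj]
      ring
    obtain ⟨C, hC, hCB⟩ := hB
    have h4 : 0 ≤ B (u k - s) (u k - s) := le_trans (by positivity) (hCB _)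
    simp only [map_sub, sub_apply] at h4
    rw [hs (u k) s, h2, h3] at h4
    linarith
  refine sum_range_le_of_weights hl
    (p := fun j => ∑ k ∈ Finset.range (n + 1), ⟪b j, J (u k)⟫_ℝ ^ 2)
    (fun j => Finset.sum_nonneg fun k _ => sq_nonneg _) (fun j => ?_) n ?_ (fun N => ?_)
  · have h := hu.sum_inner_products_le (b j) (s := Finset.range (n + 1))
    rw [hb.1] at h
    simp only [Real.norm_eq_abs, sq_abs, one_pow] at h
    refine le_trans (le_of_eq ?_) h
    exact Finset.sum_congr rfl fun k _ => by rw [real_inner_comm]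
  · have := hasSum_sum fun k (_ : k ∈ Finset.range (n + 1)) => hparseval k
    simpa using this
  · simp_rw [Finset.mul_sum]
    rw [Finset.sum_comm]
    exact Finset.sum_le_sum fun k _ => hform k N

end AbstractMinMax

/-! ### Products and sums of squares of Hermite polynomials. -/

section HermiteAlgebra

theorem hermiteH_succ (k : ℕ) :
    hermiteH (k + 1) = 2 * X * hermiteH k - derivative (hermiteH k) := rfl

theorem derivative_hermiteH_succ (k : ℕ) :
    derivative (hermiteH (k + 1)) = (2 * (k + 1) : ℝ[X]) * hermiteH k := by
  induction k with
  | zero => simp [hermiteH]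
  | succ k ih =>
    have h2 : derivative (derivative (hermiteH (k + 1)))
        = (2 * (k + 1) : ℝ[X]) * derivative (hermiteH k) := by
      rw [ih, derivative_mul]
      simp
    rw [hermiteH_succ (k + 1), derivative_sub, h2, derivative_mul, ih, hermiteH_succ k]
    simp
    ring

theorem derivative_hermiteH (k : ℕ) :
    derivative (hermiteH k) = (2 * k : ℝ[X]) * hermiteH (k - 1) := by
  cases k with
  | zero => simp [hermiteH]
  | succ k => simpa using derivative_hermiteH_succ k

/-- The linearization formula for the product of two Hermite polynomials. -/
theorem hermiteH_mul_hermiteH (n m : ℕ) :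
    hermiteH m * hermiteH n = ∑ r ∈ Finset.range (n + 1),
      C ((2 ^ r * r ! * m.choose r * n.choose r : ℕ) : ℝ) * hermiteH (m + n - 2 * r) := by
  induction n generalizing m with
  | zero => simp [hermiteH]
  | succ n ih =>
    -- The raising operator `2X - d/dX` is applied to the whole product; by Leibniz this differs
    -- from raising only the second factor by `H_m' H_n = 2m H_{m-1} H_n`.
    have h1 : hermiteH m * hermiteH (n + 1)
        = (2 * X * (hermiteH m * hermiteH n) - derivative (hermiteH m * hermiteH n))
          + (2 * m : ℝ[X]) * (hermiteH (m - 1) * hermiteH n) := by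
      rw [hermiteH_succ, derivative_mul, derivative_hermiteH m]
      ring
    have h2 : 2 * X * (hermiteH m * hermiteH n) - derivative (hermiteH m * hermiteH n)
        = ∑ r ∈ Finset.range (n + 1),
          C ((2 ^ r * r ! * m.choose r * n.choose r : ℕ) : ℝ) * hermiteH (m + (n + 1) - 2 * r) := by
      rw [ih, derivative_sum, Finset.mul_sum, ← Finset.sum_sub_distrib]
      refine Finset.sum_congr rfl fun r hr => ?_
      -- For `r > m` the natural subtraction in the index may truncate, but the coefficient is zero.
      rcases lt_or_ge m r with h | h
      · simp [Nat.choose_eq_zero_of_lt h]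
      · have : m + (n + 1) - 2 * r = (m + n - 2 * r) + 1 := by
          simp at hr; omega
        rw [this, hermiteH_succ, derivative_C_mul]
        ring
    have h3 : (2 * m : ℝ[X]) * (hermiteH (m - 1) * hermiteH n)
        = ∑ r ∈ Finset.range (n + 1),
          C ((2 ^ (r + 1) * (r + 1)! * m.choose (r + 1) * n.choose r : ℕ) : ℝ)
            * hermiteH (m + (n + 1) - 2 * (r + 1)) := by
      rw [ih, Finset.mul_sum]
      refine Finset.sum_congr rfl fun r _ => ?_
      cases m with
      | zero => simp
      | succ m =>
        have h4 : (m + 1) * m.choose r = (m + 1).choose (r + 1) * (r + 1) :=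
          Nat.add_one_mul_choose_eq m r
        have h5 : m + 1 - 1 + n - 2 * r = m + 1 + (n + 1) - 2 * (r + 1) := by omega
        have h6 : 2 ^ (r + 1) * (r + 1)! * (m + 1).choose (r + 1) * n.choose r
            = 2 * (m + 1) * (2 ^ r * r ! * m.choose r * n.choose r) := by
          rw [pow_succ, Nat.factorial_succ]
          calc _ = 2 * 2 ^ r * r ! * n.choose r * ((m + 1).choose (r + 1) * (r + 1)) := by ring
            _ = _ := by rw [← h4]; ring
        rw [h5, h6]
        simp
        rw [show (C (2 : ℝ)) = 2 from map_ofNat C 2]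
        ring
    rw [h1, h2, h3, Finset.sum_range_succ' (fun r =>
      C ((2 ^ r * r ! * m.choose r * (n + 1).choose r : ℕ) : ℝ) * hermiteH (m + (n + 1) - 2 * r)),
      Finset.sum_range_succ' (fun r =>
      C ((2 ^ r * r ! * m.choose r * n.choose r : ℕ) : ℝ) * hermiteH (m + (n + 1) - 2 * r))]
    -- Pascal's rule in `n` splits each coefficient into the contributions of `h2` and `h3`.
    have h7 : ∀ r, C ((2 ^ (r + 1) * (r + 1)! * m.choose (r + 1) * (n + 1).choose (r + 1) : ℕ) : ℝ)
          * hermiteH (m + (n + 1) - 2 * (r + 1))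
        = C ((2 ^ (r + 1) * (r + 1)! * m.choose (r + 1) * n.choose (r + 1) : ℕ) : ℝ)
          * hermiteH (m + (n + 1) - 2 * (r + 1))
        + C ((2 ^ (r + 1) * (r + 1)! * m.choose (r + 1) * n.choose r : ℕ) : ℝ)
          * hermiteH (m + (n + 1) - 2 * (r + 1)) := by
      intro r
      rw [Nat.choose_succ_succ n r]
      push_cast
      simp only [map_mul, map_add]
      ring
    simp_rw [h7]
    rw [Finset.sum_add_distrib, Finset.sum_range_succ (fun r =>
      C ((2 ^ (r + 1) * (r + 1)! * m.choose (r + 1) * n.choose (r + 1) : ℕ) : ℝ)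
          * hermiteH (m + (n + 1) - 2 * (r + 1)))]
    simp
    ring

/-- The diagonal case of linearization, reindexed by `j = m - r` so that the index `2m - 2r` becomes
`2j`. -/
theorem hermiteH_sq_div (m : ℕ) :
    C (1 / (2 ^ m * m ! : ℝ)) * hermiteH m ^ 2 = ∑ j ∈ Finset.range (m + 1),
      C ((m.choose j : ℝ) / (2 ^ j * j !)) * hermiteH (2 * j) := by
  rw [sq, hermiteH_mul_hermiteH, Finset.mul_sum, ← Finset.sum_range_reflect]
  refine Finset.sum_congr rfl fun j hj => ?_
  have hj : j ≤ m := by simp at hj; omega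
  obtain ⟨i, rfl⟩ := Nat.exists_eq_add_of_le hj
  have h1 : j + i + 1 - 1 - j = i := by omega
  have h2 : j + i + (j + i) - 2 * i = 2 * j := by omega
  rw [h1, h2, ← mul_assoc, ← map_mul]
  congr 2
  have h3 : (j + i).choose j * j ! * i ! = (j + i)! := by
    have := Nat.choose_mul_factorial_mul_factorial (Nat.le_add_right j i)
    simpa using this
  have h4 : (j + i).choose i = (j + i).choose j := by
    rw [Nat.choose_symm_add]
  rw [h4, ← h3]
  have e1 : ((j + i).choose j : ℝ) ≠ 0 := by
    exact_mod_cast (Nat.choose_pos (Nat.le_add_right j i)).ne'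
  have e2 : (j ! : ℝ) ≠ 0 := by exact_mod_cast Nat.factorial_ne_zero j
  have e3 : (i ! : ℝ) ≠ 0 := by exact_mod_cast Nat.factorial_ne_zero i
  push_cast
  rw [pow_add]
  field_simp

/-- The Christoffel sum `∑_{m ≤ n} H_m² / (2^m m!)` in terms of the Hermite polynomials. -/
theorem sum_hermiteH_sq_div (n : ℕ) :
    ∑ m ∈ Finset.range (n + 1), C (1 / (2 ^ m * m ! : ℝ)) * hermiteH m ^ 2
      = ∑ j ∈ Finset.range (n + 1),
        C (((n + 1).choose (j + 1) : ℝ) / (2 ^ j * j !)) * hermiteH (2 * j) := by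
  have h1 : ∀ m ∈ Finset.range (n + 1), C (1 / (2 ^ m * m ! : ℝ)) * hermiteH m ^ 2
      = ∑ j ∈ Finset.range (n + 1), C ((m.choose j : ℝ) / (2 ^ j * j !)) * hermiteH (2 * j) := by
    intro m hm
    rw [hermiteH_sq_div]
    refine Finset.sum_subset (fun j hj => by simp at hj hm ⊢; omega) fun j _ hj => ?_
    rw [Nat.choose_eq_zero_of_lt (by simp at hj; omega)]
    simp
  rw [Finset.sum_congr rfl h1, Finset.sum_comm]
  refine Finset.sum_congr rfl fun j hj => ?_
  rw [← Finset.sum_mul, ← map_sum, ← Finset.sum_div, ← Nat.cast_sum]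
  congr 4
  clear h1 hj
  -- What is left is the hockey-stick identity, summing `binom(m, j)` over `m ≤ n`.
  induction n with
  | zero => simp [Nat.choose_succ_succ]
  | succ n ih => rw [Finset.sum_range_succ, ih, Nat.choose_succ_succ (n + 1) j, add_comm]

end HermiteAlgebra

/-! ### Gaussian integrals, Hermite functions and their energy. -/

section GaussianWeight

theorem integrable_gauss_mul_eval (p : ℝ[X]) :
    Integrable (fun x : ℝ => Real.exp (-x ^ 2) * p.eval x) := by
  induction p using Polynomial.induction_on' with
  | add p q hp hq =>
    refine (hp.add hq).congr (Eventually.of_forall fun x => ?_)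
    simp [mul_add]
  | monomial n a =>
    have h := (integrable_rpow_mul_exp_neg_mul_sq (b := 1) one_pos
      (s := n) (by have : (0 : ℝ) ≤ n := n.cast_nonneg; linarith)).const_mul a
    refine h.congr (Eventually.of_forall fun x => ?_)
    simp
    ring

/-- Boundedness, not just integrability, is needed to multiply by a merely integrable `q`. -/
theorem exists_bound_gauss_mul_eval (p : ℝ[X]) :
    ∃ C, ∀ x : ℝ, |Real.exp (-x ^ 2) * p.eval x| ≤ C := by
  induction p using Polynomial.induction_on' with
  | add p q hp hq =>
    obtain ⟨C, hC⟩ := hp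
    obtain ⟨D, hD⟩ := hq
    refine ⟨C + D, fun x => ?_⟩
    rw [eval_add, mul_add]
    exact (abs_add_le _ _).trans (add_le_add (hC x) (hD x))
  | monomial n a =>
    refine ⟨|a| * (n ! * Real.exp 1), fun x => ?_⟩
    have h1 := Real.pow_div_factorial_le_exp |x| (abs_nonneg x) n
    rw [div_le_iff₀ (by positivity)] at h1
    have h2 : Real.exp (-x ^ 2) * Real.exp |x| ≤ Real.exp 1 := by
      rw [← Real.exp_add]
      apply Real.exp_le_exp.2
      nlinarith [sq_abs x, sq_nonneg (|x| - 1)]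
    rw [eval_monomial, abs_mul, abs_mul, abs_pow, Real.abs_exp]
    calc Real.exp (-x ^ 2) * (|a| * |x| ^ n)
        ≤ Real.exp (-x ^ 2) * (|a| * (Real.exp |x| * n !)) := by gcongr
      _ = |a| * (n ! * (Real.exp (-x ^ 2) * Real.exp |x|)) := by ring
      _ ≤ _ := by gcongr

/-- Integration of a polynomial against the weight `e^{-x²}`. -/
noncomputable def gaussInt : ℝ[X] →ₗ[ℝ] ℝ where
  toFun p := ∫ x : ℝ, Real.exp (-x ^ 2) * p.eval x
  map_add' p q := by
    rw [← integral_add (integrable_gauss_mul_eval p) (integrable_gauss_mul_eval q)]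
    simp [mul_add]
  map_smul' c p := by
    rw [RingHom.id_apply, smul_eq_mul, ← integral_const_mul]
    congr 1
    ext x
    simp
    ring

theorem gaussInt_apply (p : ℝ[X]) : gaussInt p = ∫ x : ℝ, Real.exp (-x ^ 2) * p.eval x := rfl

theorem gaussInt_one : gaussInt 1 = √Real.pi := by
  have := integral_gaussian 1
  simpa [gaussInt_apply] using this

theorem hasDerivAt_gauss_mul_eval (p : ℝ[X]) (x : ℝ) :
    HasDerivAt (fun x : ℝ => Real.exp (-x ^ 2) * p.eval x)
      (Real.exp (-x ^ 2) * (derivative p - 2 * X * p).eval x) x := by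
  have h1 : HasDerivAt (fun x : ℝ => -x ^ 2) (-(2 * x)) x := by
    refine (hasDerivAt_pow 2 x).neg.congr_deriv ?_
    simp
  refine (h1.exp.mul (p.hasDerivAt x)).congr_deriv ?_
  simp
  ring

theorem gaussInt_derivative (p : ℝ[X]) : gaussInt (derivative p) = gaussInt (2 * X * p) := by
  rw [← sub_eq_zero, ← map_sub]
  exact integral_eq_zero_of_hasDerivAt_of_integrable (hasDerivAt_gauss_mul_eval p)
    (integrable_gauss_mul_eval _) (integrable_gauss_mul_eval _)

/-- Integration by parts, since `e^{-x²} H_{k+1} = -(e^{-x²} H_k)'`. Iterating it gives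
orthogonality and the norms. -/
theorem gaussInt_hermiteH_succ_mul (k : ℕ) (p : ℝ[X]) :
    gaussInt (hermiteH (k + 1) * p) = gaussInt (hermiteH k * derivative p) := by
  have h := gaussInt_derivative (hermiteH k * p)
  rw [derivative_mul, map_add] at h
  have h2 : hermiteH (k + 1) * p = 2 * X * (hermiteH k * p) - derivative (hermiteH k) * p := by
    rw [hermiteH_succ]
    ring
  rw [h2, map_sub, ← h]
  ring

theorem gaussInt_hermiteH_mul_hermiteH (m n : ℕ) :
    gaussInt (hermiteH m * hermiteH n) = if m = n then √Real.pi * 2 ^ n * n ! else 0 := by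
  induction m generalizing n with
  | zero =>
    cases n with
    | zero => simp [hermiteH, gaussInt_one]
    | succ n =>
      rw [mul_comm, gaussInt_hermiteH_succ_mul]
      simp [hermiteH]
  | succ m ih =>
    rw [gaussInt_hermiteH_succ_mul]
    cases n with
    | zero => simp [hermiteH]
    | succ n =>
      have : hermiteH m * derivative (hermiteH (n + 1))
          = (2 * (n + 1) : ℝ) • (hermiteH m * hermiteH n) := by
        rw [derivative_hermiteH_succ, smul_eq_C_mul]
        simp
        rw [show (C (2 : ℝ)) = 2 from map_ofNat C 2]
        ring
      rw [this, map_smul, ih, Nat.factorial_succ]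
      by_cases h : m = n
      · simp [h]
        ring
      · simp [h]

/-- The normalized Hermite functions. -/
noncomputable def hermiteFn (k : ℕ) (x : ℝ) : ℝ :=
  (√(√Real.pi * 2 ^ k * k !))⁻¹ * (Real.exp (-x ^ 2 / 2) * (hermiteH k).eval x)

/-- The derivatives of the Hermite functions. -/
noncomputable def hermiteFnDeriv (k : ℕ) (x : ℝ) : ℝ :=
  (√(√Real.pi * 2 ^ k * k !))⁻¹ *
    (Real.exp (-x ^ 2 / 2) * (derivative (hermiteH k) - X * hermiteH k).eval x)

theorem hasDerivAt_hermiteFn (k : ℕ) (x : ℝ) :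
    HasDerivAt (hermiteFn k) (hermiteFnDeriv k x) x := by
  have h1 : HasDerivAt (fun x : ℝ => -x ^ 2 / 2) (-x) x := by
    refine ((hasDerivAt_pow 2 x).neg.div_const 2).congr_deriv ?_
    simp
    ring
  refine ((h1.exp.mul ((hermiteH k).hasDerivAt x)).const_mul _).congr_deriv ?_
  simp [hermiteFnDeriv]
  left
  ring

theorem exp_half_mul_self (x : ℝ) :
    Real.exp (-x ^ 2 / 2) * Real.exp (-x ^ 2 / 2) = Real.exp (-x ^ 2) := by
  rw [← Real.exp_add]
  ring_nf

theorem memLp_exp_half_mul_eval (p : ℝ[X]) :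
    MemLp (fun x : ℝ => Real.exp (-x ^ 2 / 2) * p.eval x) 2 := by
  have hc : Continuous (fun x : ℝ => Real.exp (-x ^ 2 / 2) * p.eval x) := by fun_prop
  rw [memLp_two_iff_integrable_sq hc.aestronglyMeasurable]
  refine (integrable_gauss_mul_eval (p ^ 2)).congr (Eventually.of_forall fun x => ?_)
  simp only [eval_pow, ← exp_half_mul_self]
  ring

theorem hermiteNorm_sq (k : ℕ) :
    (√(√Real.pi * 2 ^ k * k !))⁻¹ * (√(√Real.pi * 2 ^ k * k !))⁻¹
      = (√Real.pi * 2 ^ k * k !)⁻¹ := by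
  rw [← mul_inv, Real.mul_self_sqrt (by positivity)]

theorem integral_hermiteFn_mul (m n : ℕ) :
    ∫ x, hermiteFn m x * hermiteFn n x = if m = n then 1 else 0 := by
  have h1 : ∀ x, hermiteFn m x * hermiteFn n x
      = ((√(√Real.pi * 2 ^ m * m !))⁻¹ * (√(√Real.pi * 2 ^ n * n !))⁻¹) *
        (Real.exp (-x ^ 2) * (hermiteH m * hermiteH n).eval x) := by
    intro x
    rw [hermiteFn, hermiteFn, eval_mul, ← exp_half_mul_self]
    ring
  simp_rw [h1]
  rw [integral_const_mul, ← gaussInt_apply, gaussInt_hermiteH_mul_hermiteH]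
  by_cases h : m = n
  · subst h
    simp only [if_true]
    rw [hermiteNorm_sq]
    exact inv_mul_cancel₀ (by positivity)
  · simp [h]

/-- With `H_{k+1} = 2x H_k - H_k'`, the energy density is half the weight times `H_k'² + H_{k+1}²`,
up to normalization. Orthogonality makes these two terms contribute `k` and `k + 1`. -/
theorem integral_hermiteFn_energy (k : ℕ) :
    ∫ x, (hermiteFnDeriv k x ^ 2 + x ^ 2 * hermiteFn k x ^ 2) = 2 * k + 1 := by
  have h1 : ∀ x, hermiteFnDeriv k x ^ 2 + x ^ 2 * hermiteFn k x ^ 2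
      = (√Real.pi * 2 ^ k * k !)⁻¹ * (Real.exp (-x ^ 2) *
        ((1 / 2 : ℝ) • (derivative (hermiteH k) * derivative (hermiteH k)
          + hermiteH (k + 1) * hermiteH (k + 1))).eval x) := by
    intro x
    rw [hermiteFnDeriv, hermiteFn, ← exp_half_mul_self, ← hermiteNorm_sq, hermiteH_succ]
    simp
    ring
  simp_rw [h1]
  rw [integral_const_mul, ← gaussInt_apply, map_smul, map_add, gaussInt_hermiteH_mul_hermiteH]
  have h2 : gaussInt (derivative (hermiteH k) * derivative (hermiteH k))
      = 2 * k * (√Real.pi * 2 ^ k * k !) := by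
    cases k with
    | zero => simp [hermiteH]
    | succ k =>
      have : derivative (hermiteH (k + 1)) * derivative (hermiteH (k + 1))
          = ((2 * (k + 1)) * (2 * (k + 1)) : ℝ) • (hermiteH k * hermiteH k) := by
        rw [derivative_hermiteH_succ, smul_eq_C_mul]
        simp
        rw [show (C (2 : ℝ)) = 2 from map_ofNat C 2]
        ring
      rw [this, map_smul, gaussInt_hermiteH_mul_hermiteH, Nat.factorial_succ]
      simp
      ring
  rw [h2, if_pos rfl, Nat.factorial_succ]
  have : √Real.pi * 2 ^ k * k ! ≠ 0 := by positivity
  simp only [smul_eq_mul]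
  rw [inv_mul_eq_div, div_eq_iff this]
  push_cast
  ring

/-- The first-order perturbation sum in terms of the Hermite coefficients. -/
theorem sum_integral_mul_hermiteFn_sq {q : ℝ → ℝ} (hq : Integrable q) (n : ℕ) :
    ∑ k ∈ Finset.range (n + 1), ∫ x, q x * (hermiteFn k x * hermiteFn k x)
      = ∑ k ∈ Finset.range (n + 1), (2 : ℝ) ^ k * ((2 * k)! : ℝ) / (k ! : ℝ)
        * ((n + 1).choose (k + 1) : ℝ) * hermiteCoeff q (2 * k) := by
  let Λ : ℝ[X] →ₗ[ℝ] ℝ :=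
    { toFun := fun p => ∫ x : ℝ, Real.exp (-x ^ 2) * q x * p.eval x
      map_add' := fun p r => by
        have hi : ∀ p : ℝ[X], Integrable (fun x : ℝ => Real.exp (-x ^ 2) * q x * p.eval x) := by
          intro p
          obtain ⟨C, hC⟩ := exists_bound_gauss_mul_eval p
          have hc : Continuous (fun x : ℝ => Real.exp (-x ^ 2) * p.eval x) := by fun_prop
          refine (hq.bdd_mul hc.aestronglyMeasurable (Eventually.of_forall hC)).congr
            (Eventually.of_forall fun x => ?_)
          simp only
          ring
        rw [← integral_add (hi p) (hi r)]
        simp [mul_add]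
      map_smul' := fun c p => by
        rw [RingHom.id_apply, smul_eq_mul, ← integral_const_mul]
        congr 1
        ext x
        simp
        ring }
  have h1 : ∀ k, ∫ x, q x * (hermiteFn k x * hermiteFn k x)
      = (√Real.pi)⁻¹ * Λ (C (1 / (2 ^ k * k ! : ℝ)) * hermiteH k ^ 2) := by
    intro k
    rw [← smul_eq_mul, ← map_smul]
    change _ = ∫ x : ℝ, Real.exp (-x ^ 2) * q x * _
    congr 1
    ext x
    have : (√Real.pi)⁻¹ * (1 / (2 ^ k * k ! : ℝ)) = (√Real.pi * 2 ^ k * k !)⁻¹ := by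
      field_simp
    simp only [eval_smul, eval_mul, eval_C, eval_pow, smul_eq_mul]
    rw [← mul_assoc (√Real.pi)⁻¹, this, ← hermiteNorm_sq, ← exp_half_mul_self, hermiteFn]
    ring
  rw [Finset.sum_congr rfl fun k _ => h1 k, ← Finset.mul_sum, ← map_sum, sum_hermiteH_sq_div,
    map_sum, Finset.mul_sum]
  refine Finset.sum_congr rfl fun k _ => ?_
  rw [← smul_eq_C_mul, map_smul]
  change (√Real.pi)⁻¹ * (_ * ∫ x : ℝ, Real.exp (-x ^ 2) * q x * (hermiteH (2 * k)).eval x) = _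
  rw [hermiteCoeff]
  have e1 : √Real.pi ≠ 0 := by positivity
  have e2 : (k ! : ℝ) ≠ 0 := by positivity
  have e3 : ((2 * k)! : ℝ) ≠ 0 := by positivity
  field_simp
  rw [← pow_mul]
  ring

end GaussianWeight

/-! ### Cauchy–Schwarz on intervals and primitives of `L²` functions. -/

section SquareIntegrable

open scoped InnerProductSpace

/-- The Cauchy–Schwarz inequality for an interval integral. -/
theorem sq_intervalIntegral_le {v : ℝ → ℝ} {a b : ℝ} (hab : a ≤ b)
    (hv : IntervalIntegrable v volume a b)
    (hv2 : IntervalIntegrable (fun x => v x ^ 2) volume a b) :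
    (∫ x in a..b, v x) ^ 2 ≤ (b - a) * ∫ x in a..b, v x ^ 2 := by
  rcases hab.eq_or_lt with rfl | hlt
  · simp
  set s := ∫ x in a..b, v x
  have hpos : 0 < b - a := sub_pos.2 hlt
  -- The variance about the mean `s / (b - a)` is nonnegative.
  have h1 : 0 ≤ ∫ x in a..b, (v x - s / (b - a)) ^ 2 :=
    intervalIntegral.integral_nonneg hab fun x _ => sq_nonneg _
  have h2 : ∫ x in a..b, (v x - s / (b - a)) ^ 2
      = (∫ x in a..b, v x ^ 2) - 2 * (s / (b - a)) * s + (s / (b - a)) ^ 2 * (b - a) := by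
    have h3 : ∀ x, (v x - s / (b - a)) ^ 2
        = v x ^ 2 - 2 * (s / (b - a)) * v x + (s / (b - a)) ^ 2 := fun x => by ring
    simp_rw [h3]
    rw [intervalIntegral.integral_add (hv2.sub (hv.const_mul _)) intervalIntegrable_const,
      intervalIntegral.integral_sub hv2 (hv.const_mul _), intervalIntegral.integral_const_mul,
      intervalIntegral.integral_const, smul_eq_mul]
    ring
  rw [h2] at h1
  have h4 : 2 * (s / (b - a)) * s - (s / (b - a)) ^ 2 * (b - a) = s ^ 2 / (b - a) := by
    field_simp
    ring
  have h5 : s ^ 2 / (b - a) ≤ ∫ x in a..b, v x ^ 2 := by linarith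
  rw [div_le_iff₀ hpos] at h5
  linarith

theorem MemLp.intervalIntegrable_two {v : ℝ → ℝ} (hv : MemLp v 2) (a b : ℝ) :
    IntervalIntegrable v volume a b :=
  ((hv.locallyIntegrable (by norm_num)).integrableOn_isCompact isCompact_uIcc).intervalIntegrable

theorem intervalIntegral_le_integral_of_nonneg {g : ℝ → ℝ} (hg : Integrable g)
    (h0 : ∀ x, 0 ≤ g x) {a b : ℝ} (hab : a ≤ b) : ∫ x in a..b, g x ≤ ∫ x, g x := by
  rw [intervalIntegral.integral_of_le hab]
  exact setIntegral_le_integral hg (Eventually.of_forall h0)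

/-- The real Hilbert space `L²(ℝ)`. -/
abbrev RealL2 : Type := Lp ℝ 2 (volume : Measure ℝ)

theorem RealL2.norm_sq (v : RealL2) : ‖v‖ ^ 2 = ∫ x, v x ^ 2 := by
  rw [← real_inner_self_eq_norm_sq, L2.inner_def]
  simp [sq]

theorem RealL2.inner_eq (v w : RealL2) : ⟪v, w⟫_ℝ = ∫ x, v x * w x := by
  rw [L2.inner_def]
  simp [mul_comm]

theorem RealL2.integrable_sq (v : RealL2) : Integrable (fun x => v x ^ 2) :=
  (Lp.memLp v).integrable_sq

theorem RealL2.intervalIntegrable (v : RealL2) (a b : ℝ) : IntervalIntegrable v volume a b :=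
  MemLp.intervalIntegrable_two (Lp.memLp v) a b

theorem RealL2.sq_intervalIntegral_le (v : RealL2) (a b : ℝ) :
    (∫ x in a..b, v x) ^ 2 ≤ |b - a| * ‖v‖ ^ 2 := by
  wlog hab : a ≤ b generalizing a b
  · rw [intervalIntegral.integral_symm, neg_sq, abs_sub_comm]
    exact this b a (by linarith)
  rw [abs_of_nonneg (sub_nonneg.2 hab), v.norm_sq]
  refine (_root_.sq_intervalIntegral_le hab (v.intervalIntegrable a b)
    v.integrable_sq.intervalIntegrable).trans ?_
  exact mul_le_mul_of_nonneg_left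
    (intervalIntegral_le_integral_of_nonneg v.integrable_sq (fun x => sq_nonneg _) hab)
    (sub_nonneg.2 hab)

/-- The primitive at `x` of an `L²` function, as a continuous functional. -/
noncomputable def RealL2.primitive (x : ℝ) : RealL2 →L[ℝ] ℝ :=
  LinearMap.mkContinuous
    { toFun := fun v => ∫ t in (0 : ℝ)..x, v t
      map_add' := fun v w => by
        rw [← intervalIntegral.integral_add (v.intervalIntegrable 0 x) (w.intervalIntegrable 0 x)]
        apply intervalIntegral.integral_congr_ae
        filter_upwards [Lp.coeFn_add v w] with t ht _
        simpa using ht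
      map_smul' := fun c v => by
        rw [RingHom.id_apply, smul_eq_mul, ← intervalIntegral.integral_const_mul]
        apply intervalIntegral.integral_congr_ae
        filter_upwards [Lp.coeFn_smul c v] with t ht _
        simpa using ht }
    (√|x|) (fun v => by
      have h := v.sq_intervalIntegral_le 0 x
      rw [sub_zero] at h
      rw [Real.norm_eq_abs]
      apply abs_le_of_sq_le_sq _ (by positivity)
      rw [mul_pow, Real.sq_sqrt (abs_nonneg x)]
      exact h)

end SquareIntegrable

/-! ### The form domain and its Sobolev inequality. -/

section FormDomain

open scoped InnerProductSpace

/-- The ambient Hilbert space `ℝ × L² × L²` of the form domain: an element records `u 0`, `u'` and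
`√(1 + x²) u`. -/
abbrev FormAmbient : Type := WithLp 2 (ℝ × WithLp 2 (RealL2 × RealL2))

/-- The function with value `e.1` at `0` and derivative `e.2.1`, evaluated at `x`. -/
noncomputable def FormAmbient.eval (x : ℝ) : FormAmbient →L[ℝ] ℝ :=
  WithLp.fstL 2 ℝ ℝ (WithLp 2 (RealL2 × RealL2)) +
    RealL2.primitive x ∘L WithLp.fstL 2 ℝ RealL2 RealL2 ∘L
      WithLp.sndL 2 ℝ ℝ (WithLp 2 (RealL2 × RealL2))

theorem FormAmbient.eval_apply (x : ℝ) (e : FormAmbient) :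
    FormAmbient.eval x e = e.fst + ∫ t in (0 : ℝ)..x, e.snd.fst t := rfl

/-- The form domain of the harmonic oscillator, the functions `u` with `u'` and `√(1 + x²) u` in
`L²`, as a subspace of `ℝ × L² × L²`. -/
noncomputable def formSubmodule : Submodule ℝ FormAmbient where
  carrier := {e | (e.snd.snd : ℝ → ℝ) =ᵐ[volume] fun x => √(1 + x ^ 2) * FormAmbient.eval x e}
  zero_mem' := by
    filter_upwards [Lp.coeFn_zero ℝ 2 (volume : Measure ℝ)] with x hx
    rw [map_zero, mul_zero]
    exact hx
  add_mem' := by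
    intro e f he hf
    filter_upwards [he, hf, Lp.coeFn_add e.snd.snd f.snd.snd] with x h1 h2 h3
    rw [map_add, mul_add, ← h1, ← h2]
    exact h3
  smul_mem' := by
    intro c e he
    filter_upwards [he, Lp.coeFn_smul c e.snd.snd] with x h1 h2
    rw [map_smul, smul_eq_mul, mul_left_comm, ← h1]
    exact h2

/-- Recording `u 0` makes every point evaluation a continuous functional, so the defining relation
passes to limits along a subsequence converging almost everywhere. -/
theorem isClosed_formSubmodule : IsClosed (formSubmodule : Set FormAmbient) := by
  rw [← isSeqClosed_iff_isClosed]
  intro e f he hlim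
  have h1 : Tendsto (fun n => (e n).snd.snd) atTop (nhds f.snd.snd) :=
    ((WithLp.sndL 2 ℝ RealL2 RealL2 ∘L
      WithLp.sndL 2 ℝ ℝ (WithLp 2 (RealL2 × RealL2))).continuous.tendsto f).comp hlim
  obtain ⟨ns, hns, hae⟩ := (tendstoInMeasure_of_tendsto_Lp h1).exists_seq_tendsto_ae
  have h2 : ∀ᵐ x : ℝ, ∀ n, (e n).snd.snd x = √(1 + x ^ 2) * FormAmbient.eval x (e n) :=
    ae_all_iff.2 he
  change (f.snd.snd : ℝ → ℝ) =ᵐ[volume] fun x => √(1 + x ^ 2) * FormAmbient.eval x f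
  filter_upwards [hae, h2] with x hx h2x
  refine tendsto_nhds_unique hx ?_
  simp_rw [h2x]
  exact (((FormAmbient.eval x).continuous.tendsto f).comp (hlim.comp hns.tendsto_atTop)).const_mul _

/-- The form domain of the harmonic oscillator as a Hilbert space. -/
def FormDomain : Type := formSubmodule

namespace FormDomain

noncomputable instance : NormedAddCommGroup FormDomain :=
  inferInstanceAs (NormedAddCommGroup formSubmodule)

noncomputable instance : InnerProductSpace ℝ FormDomain :=
  inferInstanceAs (InnerProductSpace ℝ formSubmodule)

instance : CompleteSpace FormDomain := isClosed_formSubmodule.completeSpace_coe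

/-- The inclusion into the ambient space. -/
noncomputable def val : FormDomain →L[ℝ] FormAmbient := formSubmodule.subtypeL

/-- Evaluation at a point, a continuous functional on the form domain. -/
noncomputable def evalL (x : ℝ) : FormDomain →L[ℝ] ℝ := FormAmbient.eval x ∘L val

/-- The continuous function represented by an element of the form domain. -/
noncomputable def fn (e : FormDomain) (x : ℝ) : ℝ := evalL x e

/-- The weak derivative. -/
noncomputable def der : FormDomain →L[ℝ] RealL2 :=
  WithLp.fstL 2 ℝ RealL2 RealL2 ∘L WithLp.sndL 2 ℝ ℝ (WithLp 2 (RealL2 × RealL2)) ∘L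
    val

/-- Multiplication by the weight `√(1 + x²)`. -/
noncomputable def wgt : FormDomain →L[ℝ] RealL2 :=
  WithLp.sndL 2 ℝ RealL2 RealL2 ∘L WithLp.sndL 2 ℝ ℝ (WithLp 2 (RealL2 × RealL2)) ∘L
    val

theorem fn_add (e f : FormDomain) (x : ℝ) : fn (e + f) x = fn e x + fn f x := map_add _ _ _

theorem fn_sub (e f : FormDomain) (x : ℝ) : fn (e - f) x = fn e x - fn f x := map_sub _ _ _

theorem fn_smul (c : ℝ) (e : FormDomain) (x : ℝ) : fn (c • e) x = c * fn e x := map_smul _ _ _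

theorem fn_eq (e : FormDomain) (x : ℝ) : fn e x = fn e 0 + ∫ t in (0 : ℝ)..x, der e t := by
  have h : ∀ y, fn e y = (val e).fst + ∫ t in (0 : ℝ)..y, der e t := fun y => rfl
  rw [h x, h 0]
  simp

theorem fn_sub_fn (e : FormDomain) (x y : ℝ) : fn e y - fn e x = ∫ t in x..y, der e t := by
  rw [fn_eq e x, fn_eq e y, ← intervalIntegral.integral_interval_sub_left
    ((der e).intervalIntegrable 0 y) ((der e).intervalIntegrable 0 x)]
  ring

theorem coeFn_wgt (e : FormDomain) : wgt e =ᵐ[volume] fun x => √(1 + x ^ 2) * fn e x :=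
  Subtype.property (p := (· ∈ formSubmodule)) e

theorem continuous_fn (e : FormDomain) : Continuous (fn e) := by
  have h : fn e = fun x => fn e 0 + ∫ t in (0 : ℝ)..x, der e t := funext (fn_eq e)
  rw [h]
  exact continuous_const.add (intervalIntegral.continuous_primitive
    (fun a b => (der e).intervalIntegrable a b) 0)

theorem one_le_weight (x : ℝ) : 1 ≤ √(1 + x ^ 2) := by
  rw [Real.one_le_sqrt]
  nlinarith [sq_nonneg x]

theorem ae_abs_fn_le (e : FormDomain) : ∀ᵐ x, ‖fn e x‖ ≤ ‖wgt e x‖ := by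
  filter_upwards [coeFn_wgt e] with x hx
  rw [hx, norm_mul, Real.norm_eq_abs (√_), abs_of_nonneg (Real.sqrt_nonneg _)]
  exact le_mul_of_one_le_left (norm_nonneg _) (one_le_weight x)

theorem memLp_fn (e : FormDomain) : MemLp (fn e) 2 :=
  (Lp.memLp (wgt e)).of_le (continuous_fn e).aestronglyMeasurable (ae_abs_fn_le e)

/-- The embedding of the form domain into `L²`. -/
noncomputable def emb : FormDomain →L[ℝ] RealL2 :=
  LinearMap.mkContinuous
    { toFun := fun e => (memLp_fn e).toLp (fn e)
      map_add' := fun e f => by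
        rw [← MemLp.toLp_add]
        congr 1
        exact funext (fn_add e f)
      map_smul' := fun c e => by
        rw [RingHom.id_apply, ← MemLp.toLp_const_smul]
        congr 1
        exact funext (fn_smul c e) }
    1 (fun e => by
      rw [one_mul]
      have h1 : ‖(memLp_fn e).toLp (fn e)‖ ≤ ‖wgt e‖ := by
        apply Lp.norm_le_norm_of_ae_le
        filter_upwards [(memLp_fn e).coeFn_toLp, ae_abs_fn_le e] with x hx h
        rwa [hx]
      have h2 : ‖wgt e‖ ≤ ‖e‖ := by
        have h3 := WithLp.prod_norm_sq_eq_of_L2 (val e)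
        have h4 := WithLp.prod_norm_sq_eq_of_L2 (val e).snd
        have h5 : ‖wgt e‖ ^ 2 ≤ ‖e‖ ^ 2 := by
          change ‖(val e).snd.snd‖ ^ 2 ≤ ‖val e‖ ^ 2
          nlinarith [sq_nonneg ‖(val e).fst‖, sq_nonneg ‖(val e).snd.fst‖]
        exact le_of_sq_le_sq h5 (norm_nonneg _)
      exact h1.trans h2)

theorem coeFn_emb (e : FormDomain) : emb e =ᵐ[volume] fn e := (memLp_fn e).coeFn_toLp

theorem norm_emb_le_norm_wgt (e : FormDomain) : ‖emb e‖ ≤ ‖wgt e‖ := by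
  apply Lp.norm_le_norm_of_ae_le
  filter_upwards [coeFn_emb e, ae_abs_fn_le e] with x hx h
  rwa [hx]

theorem norm_emb_sq (e : FormDomain) : ‖emb e‖ ^ 2 = ∫ x, fn e x ^ 2 := by
  rw [RealL2.norm_sq]
  exact integral_congr_ae ((coeFn_emb e).mono fun x hx => by simp only [hx])

/-- A function with a weak derivative and the required integrability belongs to the form domain. -/
theorem exists_of_memLp {u v : ℝ → ℝ} (hv : MemLp v 2)
    (hu : ∀ x, u x = u 0 + ∫ t in (0 : ℝ)..x, v t)
    (hw : MemLp (fun x => √(1 + x ^ 2) * u x) 2) :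
    ∃ e : FormDomain, fn e = u ∧ der e =ᵐ[volume] v := by
  let a : FormAmbient := WithLp.toLp 2 (u 0, WithLp.toLp 2 (hv.toLp v, hw.toLp _))
  have h1 : ∀ x, FormAmbient.eval x a = u x := by
    intro x
    rw [FormAmbient.eval_apply, hu x]
    congr 1
    apply intervalIntegral.integral_congr_ae
    filter_upwards [hv.coeFn_toLp] with t ht _ using ht
  have h2 : a ∈ formSubmodule := by
    change (hw.toLp _ : RealL2) =ᵐ[volume] fun x => √(1 + x ^ 2) * FormAmbient.eval x a
    simp_rw [h1]
    exact hw.coeFn_toLp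
  exact ⟨⟨a, h2⟩, funext h1, hv.coeFn_toLp⟩

/-- The Sobolev inequality with a small constant in front of the derivative. -/
theorem fn_sq_le (e : FormDomain) {δ : ℝ} (hδ : 0 < δ) (x : ℝ) :
    fn e x ^ 2 ≤ 2 / δ * ‖emb e‖ ^ 2 + 2 * δ * ‖der e‖ ^ 2 := by
  -- From `u(x)² ≤ 2 u(y)² + 2 (u(y) - u(x))²` and Cauchy–Schwarz for the increment; averaging over
  -- `y` in `[x, x + δ]` then yields the claim.
  have h1 : ∀ y ∈ Set.Icc x (x + δ), fn e x ^ 2 ≤ 2 * fn e y ^ 2 + 2 * δ * ‖der e‖ ^ 2 := by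
    intro y hy
    have h2 := (der e).sq_intervalIntegral_le x y
    rw [← fn_sub_fn] at h2
    have h3 : |y - x| ≤ δ := by
      rw [abs_of_nonneg (by linarith [hy.1])]
      linarith [hy.2]
    have h4 : |y - x| * ‖der e‖ ^ 2 ≤ δ * ‖der e‖ ^ 2 := by gcongr
    nlinarith [sq_nonneg (2 * fn e y - fn e x)]
  have h5 := intervalIntegral.integral_mono_on (a := x) (b := x + δ) (μ := volume) (by linarith)
    intervalIntegrable_const
    (Continuous.intervalIntegrable (by have := continuous_fn e; fun_prop) _ _) h1
  have h6 : ∫ y in x..(x + δ), (2 * fn e y ^ 2 + 2 * δ * ‖der e‖ ^ 2)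
      = 2 * (∫ y in x..(x + δ), fn e y ^ 2) + δ * (2 * δ * ‖der e‖ ^ 2) := by
    rw [intervalIntegral.integral_add
      (Continuous.intervalIntegrable (by have := continuous_fn e; fun_prop) _ _)
      intervalIntegrable_const, intervalIntegral.integral_const_mul,
      intervalIntegral.integral_const, smul_eq_mul]
    ring
  have h7 := intervalIntegral_le_integral_of_nonneg (memLp_fn e).integrable_sq
    (fun y => sq_nonneg _) (show x ≤ x + δ by linarith)
  rw [← norm_emb_sq] at h7
  rw [h6, intervalIntegral.integral_const, smul_eq_mul, add_sub_cancel_left] at h5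
  have h8 : fn e x ^ 2 ≤ (2 * ‖emb e‖ ^ 2 + δ * (2 * δ * ‖der e‖ ^ 2)) / δ := by
    rw [le_div_iff₀ hδ]
    linarith
  refine h8.trans (le_of_eq ?_)
  field_simp

/-- The extra coordinate `u 0` costs at most twice the rest, by the Sobolev inequality with `δ = 1`;
hence the `3`. -/
theorem norm_sq_le (e : FormDomain) : ‖e‖ ^ 2 ≤ 3 * (‖der e‖ ^ 2 + ‖wgt e‖ ^ 2) := by
  have h3 := WithLp.prod_norm_sq_eq_of_L2 (val e)
  have h4 := WithLp.prod_norm_sq_eq_of_L2 (val e).snd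
  have h5 : fn e 0 = (val e).fst := by
    change FormAmbient.eval 0 (val e) = _
    rw [FormAmbient.eval_apply]
    simp
  have h6 := fn_sq_le e one_pos 0
  have h7 : ‖emb e‖ ^ 2 ≤ ‖wgt e‖ ^ 2 :=
    pow_le_pow_left₀ (norm_nonneg _) (norm_emb_le_norm_wgt e) 2
  rw [h5] at h6
  change ‖val e‖ ^ 2 ≤ 3 * (‖(val e).snd.fst‖ ^ 2 + ‖(val e).snd.snd‖ ^ 2)
  have h8 : ‖der e‖ = ‖(val e).snd.fst‖ := rfl
  have h9 : ‖wgt e‖ = ‖(val e).snd.snd‖ := rfl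
  rw [h8] at h6
  rw [h9] at h7
  rw [h3, h4, Real.norm_eq_abs, sq_abs]
  linarith

theorem norm_der_sq_le (e : FormDomain) : ‖der e‖ ^ 2 + ‖wgt e‖ ^ 2 ≤ ‖e‖ ^ 2 := by
  have h3 := WithLp.prod_norm_sq_eq_of_L2 (val e)
  have h4 := WithLp.prod_norm_sq_eq_of_L2 (val e).snd
  change ‖(val e).snd.fst‖ ^ 2 + ‖(val e).snd.snd‖ ^ 2
    ≤ ‖val e‖ ^ 2
  nlinarith [sq_nonneg ‖(val e).fst‖]

theorem abs_fn_le (e : FormDomain) (x : ℝ) : |fn e x| ≤ 2 * ‖e‖ := by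
  apply abs_le_of_sq_le_sq _ (by positivity)
  have h1 := fn_sq_le e one_pos x
  have h2 := norm_der_sq_le e
  have h3 : ‖emb e‖ ^ 2 ≤ ‖wgt e‖ ^ 2 :=
    pow_le_pow_left₀ (norm_nonneg _) (norm_emb_le_norm_wgt e) 2
  nlinarith

end FormDomain

end FormDomain

/-! ### Compactness of the embedding into `L²`. -/

section Compactness

theorem RealL2.coeFn_sum {ι : Type*} (s : Finset ι) (f : ι → RealL2) :
    (∑ i ∈ s, f i : RealL2) =ᵐ[volume] fun x => ∑ i ∈ s, f i x := by
  classical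
  induction s using Finset.induction_on with
  | empty =>
    simp only [Finset.sum_empty]
    exact Lp.coeFn_zero ℝ 2 (volume : Measure ℝ)
  | insert i s hi ih =>
    rw [Finset.sum_insert hi]
    filter_upwards [ih, Lp.coeFn_add (f i) (∑ j ∈ s, f j)] with x h1 h2
    rw [h2, Pi.add_apply, h1, Finset.sum_insert hi]

namespace FormDomain

/-- The `i`-th point of the grid of mesh `1 / N` starting at `-N`. -/
noncomputable def gridPt (N i : ℕ) : ℝ := -N + i / N

theorem mem_Ico_gridPt {N : ℕ} (hN : 0 < N) (i : ℕ) (x : ℝ) :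
    x ∈ Set.Ico (gridPt N i) (gridPt N (i + 1)) ↔ -(N : ℝ) ≤ x ∧ i = ⌊(x + N) * N⌋₊ := by
  have hN' : (0 : ℝ) < N := by exact_mod_cast hN
  have h1 : gridPt N i ≤ x ↔ (i : ℝ) ≤ (x + N) * N := by
    rw [gridPt, ← div_le_iff₀ hN']
    constructor <;> intro h <;> linarith
  have h2 : x < gridPt N (i + 1) ↔ (x + N) * N < i + 1 := by
    rw [gridPt, ← lt_div_iff₀ hN']
    push_cast
    constructor <;> intro h <;> linarith
  rw [Set.mem_Ico, h1, h2]
  constructor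
  · rintro ⟨h3, h4⟩
    have h5 : 0 ≤ (x + N) * N := le_trans (Nat.cast_nonneg i) h3
    have h6 : 0 ≤ x + N := nonneg_of_mul_nonneg_left h5 hN'
    exact ⟨by linarith, ((Nat.floor_eq_iff h5).2 ⟨h3, h4⟩).symm⟩
  · rintro ⟨h3, h4⟩
    exact (Nat.floor_eq_iff (mul_nonneg (by linarith) hN'.le)).1 h4.symm

/-- Approximation by step functions on a grid, an operator of finite rank. -/
noncomputable def stepApprox (N : ℕ) : FormDomain →L[ℝ] RealL2 :=
  ∑ i ∈ Finset.range (2 * N * N), (evalL (gridPt N i)).smulRight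
    (indicatorConstLp 2 (measurableSet_Ico (a := gridPt N i) (b := gridPt N (i + 1)))
      measure_Ico_lt_top.ne (1 : ℝ))

theorem isCompactOperator_stepApprox (N : ℕ) : IsCompactOperator (stepApprox N) := by
  refine Submodule.sum_mem (compactOperator (RingHom.id ℝ) FormDomain RealL2) fun i _ => ?_
  exact (isCompactOperator_of_locallyCompactSpace_rng
    (ContinuousLinearMap.toSpanSingleton ℝ _)).comp_clm (evalL (gridPt N i))

theorem coeFn_stepApprox (N : ℕ) (e : FormDomain) :
    ∀ᵐ x, stepApprox N e x = ∑ i ∈ Finset.range (2 * N * N),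
      fn e (gridPt N i) *
        (Set.Ico (gridPt N i) (gridPt N (i + 1))).indicator (fun _ => (1 : ℝ)) x := by
  have h1 : stepApprox N e = ∑ i ∈ Finset.range (2 * N * N), fn e (gridPt N i) •
      (indicatorConstLp 2 (measurableSet_Ico (a := gridPt N i) (b := gridPt N (i + 1)))
      measure_Ico_lt_top.ne (1 : ℝ) : RealL2) := by
    simp [stepApprox, sum_apply, fn]
  rw [h1]
  have h2 : ∀ᵐ x, ∀ i, (fn e (gridPt N i) •
      (indicatorConstLp 2 (measurableSet_Ico (a := gridPt N i) (b := gridPt N (i + 1)))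
      measure_Ico_lt_top.ne (1 : ℝ) : RealL2) : RealL2) x = fn e (gridPt N i) *
        (Set.Ico (gridPt N i) (gridPt N (i + 1))).indicator (fun _ => (1 : ℝ)) x := by
    refine ae_all_iff.2 fun i => ?_
    filter_upwards [Lp.coeFn_smul (fn e (gridPt N i))
      (indicatorConstLp 2 (measurableSet_Ico (a := gridPt N i) (b := gridPt N (i + 1)))
      measure_Ico_lt_top.ne (1 : ℝ) : RealL2), indicatorConstLp_coeFn (p := 2) (c := (1 : ℝ))
      (hs := measurableSet_Ico (a := gridPt N i) (b := gridPt N (i + 1)))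
      (hμs := (measure_Ico_lt_top (μ := (volume : Measure ℝ))).ne)] with x hx hx2
    rw [hx, Pi.smul_apply, hx2, smul_eq_mul]
  have h3 := RealL2.coeFn_sum (Finset.range (2 * N * N)) fun i => (fn e (gridPt N i) •
      (indicatorConstLp 2 (measurableSet_Ico (a := gridPt N i) (b := gridPt N (i + 1)))
      measure_Ico_lt_top.ne (1 : ℝ) : RealL2) : RealL2)
  filter_upwards [h2, h3] with x hx hx3
  rw [hx3]
  exact Finset.sum_congr rfl fun i _ => hx i

theorem gridPt_le_succ (N i : ℕ) : gridPt N i ≤ gridPt N (i + 1) := by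
  rw [gridPt, gridPt]
  gcongr
  omega

theorem gridPt_succ_sub (N i : ℕ) : gridPt N (i + 1) - gridPt N i = 1 / N := by
  rw [gridPt, gridPt]
  push_cast
  ring

/-- Inside `[-N, N)` the error is an increment of `u` over at most one cell, bounded by
Cauchy–Schwarz. Outside, the step function vanishes and the weight gives `u² ≤ (1 + x²) u² / N²`. -/
theorem sq_emb_sub_stepApprox_le {N : ℕ} (hN : 0 < N) (e : FormDomain) :
    ∀ᵐ x, (emb e - stepApprox N e : RealL2) x ^ 2 ≤ (1 / N : ℝ) ^ 2 * wgt e x ^ 2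
      + ∑ i ∈ Finset.range (2 * N * N), (Set.Ico (gridPt N i) (gridPt N (i + 1))).indicator
        (fun _ => (1 / N : ℝ) * ∫ t in gridPt N i..gridPt N (i + 1), der e t ^ 2) x := by
  have hN' : (0 : ℝ) < N := by exact_mod_cast hN
  filter_upwards [coeFn_stepApprox N e, coeFn_emb e, coeFn_wgt e,
    Lp.coeFn_sub (emb e) (stepApprox N e)] with x h1 h2 h3 h4
  rw [h4, Pi.sub_apply, h1, h2, h3]
  have hw : (√(1 + x ^ 2) * fn e x) ^ 2 = (1 + x ^ 2) * fn e x ^ 2 := by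
    rw [mul_pow, Real.sq_sqrt (by positivity)]
  rw [hw]
  have hnonneg : 0 ≤ (1 / N : ℝ) ^ 2 * ((1 + x ^ 2) * fn e x ^ 2) := by positivity
  by_cases hx : -(N : ℝ) ≤ x ∧ x < N
  · set k := ⌊(x + N) * N⌋₊ with hk
    have hkm : x ∈ Set.Ico (gridPt N k) (gridPt N (k + 1)) :=
      (mem_Ico_gridPt hN k x).2 ⟨hx.1, rfl⟩
    have hklt : k ∈ Finset.range (2 * N * N) := by
      rw [Finset.mem_range, hk, Nat.floor_lt (mul_nonneg (by linarith [hx.1]) hN'.le)]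
      push_cast
      exact mul_lt_mul_of_pos_right (by linarith [hx.2]) hN'
    have hne : ∀ i ∈ Finset.range (2 * N * N), i ≠ k →
        x ∉ Set.Ico (gridPt N i) (gridPt N (i + 1)) := fun i _ hik hmem =>
      hik ((mem_Ico_gridPt hN i x).1 hmem).2
    rw [Finset.sum_eq_single_of_mem k hklt fun i hi hik => by
        rw [Set.indicator_of_notMem (hne i hi hik), mul_zero],
      Finset.sum_eq_single_of_mem k hklt fun i hi hik =>
        Set.indicator_of_notMem (hne i hi hik) _, Set.indicator_of_mem hkm,
      Set.indicator_of_mem hkm, mul_one, fn_sub_fn]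
    have h5 := sq_intervalIntegral_le hkm.1 ((der e).intervalIntegrable (gridPt N k) x)
      (der e).integrable_sq.intervalIntegrable
    have h6 : ∫ t in gridPt N k..x, der e t ^ 2
        ≤ ∫ t in gridPt N k..gridPt N (k + 1), der e t ^ 2 :=
      intervalIntegral.integral_mono_interval le_rfl hkm.1 hkm.2.le
        (Eventually.of_forall fun t => sq_nonneg _) (der e).integrable_sq.intervalIntegrable
    have h7 : x - gridPt N k ≤ 1 / N := by
      rw [← gridPt_succ_sub N k]
      linarith [hkm.2]
    have h8 : 0 ≤ ∫ t in gridPt N k..x, der e t ^ 2 :=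
      intervalIntegral.integral_nonneg hkm.1 fun t _ => sq_nonneg _
    have h9 : (x - gridPt N k) * ∫ t in gridPt N k..x, der e t ^ 2
        ≤ (1 / N : ℝ) * ∫ t in gridPt N k..gridPt N (k + 1), der e t ^ 2 := by
      gcongr
    linarith
  · have hne : ∀ i ∈ Finset.range (2 * N * N),
        x ∉ Set.Ico (gridPt N i) (gridPt N (i + 1)) := by
      intro i hi hmem
      have h5 := (mem_Ico_gridPt hN i x).1 hmem
      refine hx ⟨h5.1, ?_⟩
      have h6 : ⌊(x + N) * N⌋₊ < 2 * N * N := h5.2 ▸ Finset.mem_range.1 hi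
      rw [Nat.floor_lt (mul_nonneg (by linarith [h5.1]) hN'.le)] at h6
      push_cast at h6
      have := lt_of_mul_lt_mul_right h6 hN'.le
      linarith
    rw [Finset.sum_eq_zero fun i hi => by
        rw [Set.indicator_of_notMem (hne i hi), mul_zero],
      Finset.sum_eq_zero fun i hi => Set.indicator_of_notMem (hne i hi) _, sub_zero, add_zero]
    have h5 : (N : ℝ) ^ 2 ≤ x ^ 2 := by
      rw [not_and_or, not_le, not_lt] at hx
      rcases hx with h | h <;> nlinarith
    have h6 : 1 ≤ (1 / N : ℝ) ^ 2 * (1 + x ^ 2) := by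
      rw [one_div, inv_pow, inv_mul_eq_div, le_div_iff₀ (by positivity)]
      linarith
    calc fn e x ^ 2 = 1 * fn e x ^ 2 := (one_mul _).symm
      _ ≤ ((1 / N : ℝ) ^ 2 * (1 + x ^ 2)) * fn e x ^ 2 := by gcongr
      _ = _ := by ring

/-- Integrating the pointwise bound over cells of length `1 / N` gives at most `(‖wgt e‖² + ‖der
e‖²) / N²`. So the embedding is a norm limit of finite-rank operators. -/
theorem norm_stepApprox_sub_emb_le {N : ℕ} (hN : 0 < N) :
    ‖stepApprox N - emb‖ ≤ 1 / N := by
  refine ContinuousLinearMap.opNorm_le_bound _ (by positivity) fun e => ?_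
  have h0 : ‖(stepApprox N - emb) e‖ ^ 2 ≤ (1 / N * ‖e‖) ^ 2 := by
    change ‖stepApprox N e - emb e‖ ^ 2 ≤ _
    rw [norm_sub_rev, RealL2.norm_sq]
    have hi : ∀ i, Integrable ((Set.Ico (gridPt N i) (gridPt N (i + 1))).indicator
        (fun _ => (1 / N : ℝ) * ∫ t in gridPt N i..gridPt N (i + 1), der e t ^ 2)) := fun i =>
      (integrable_indicator_iff measurableSet_Ico).2 (integrableOn_const measure_Ico_lt_top.ne)
    have h1 := integral_mono_ae (RealL2.integrable_sq _)
      (((wgt e).integrable_sq.const_mul _).add (integrable_finsetSum _ fun i _ => hi i))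
      (sq_emb_sub_stepApprox_le hN e)
    refine h1.trans ?_
    simp only [Pi.add_apply]
    rw [integral_add ((wgt e).integrable_sq.const_mul _) (integrable_finsetSum _ fun i _ => hi i),
      integral_const_mul, ← RealL2.norm_sq, integral_finsetSum _ fun i _ => hi i]
    have h2 : ∀ i, ∫ x, (Set.Ico (gridPt N i) (gridPt N (i + 1))).indicator
        (fun _ => (1 / N : ℝ) * ∫ t in gridPt N i..gridPt N (i + 1), der e t ^ 2) x
        = (1 / N : ℝ) ^ 2 * ∫ t in gridPt N i..gridPt N (i + 1), der e t ^ 2 := by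
      intro i
      rw [integral_indicator measurableSet_Ico, setIntegral_const, measureReal_def,
        Real.volume_Ico, gridPt_succ_sub, ENNReal.toReal_ofReal (by positivity), smul_eq_mul]
      ring
    simp_rw [h2]
    rw [← Finset.mul_sum, intervalIntegral.sum_integral_adjacent_intervals fun i _ =>
      (der e).integrable_sq.intervalIntegrable]
    have h3 := intervalIntegral_le_integral_of_nonneg (der e).integrable_sq
      (fun x => sq_nonneg _) (monotone_nat_of_le_succ (gridPt_le_succ N) (Nat.zero_le (2 * N * N)))
    rw [← RealL2.norm_sq] at h3
    have h4 := norm_der_sq_le e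
    rw [mul_pow, ← mul_add]
    gcongr
    linarith
  exact le_of_sq_le_sq h0 (by positivity)

theorem isCompactOperator_emb : IsCompactOperator emb := by
  refine isCompactOperator_of_tendsto (l := atTop) (F := stepApprox) ?_
    (Eventually.of_forall isCompactOperator_stepApprox)
  refine (tendsto_iff_norm_sub_tendsto_zero (E := FormDomain →L[ℝ] RealL2)).2 ?_
  refine squeeze_zero' (Eventually.of_forall fun _ => ContinuousLinearMap.opNorm_nonneg _) ?_
    tendsto_one_div_atTop_nhds_zero_nat
  filter_upwards [eventually_gt_atTop 0] with N hN
  exact norm_stepApprox_sub_emb_le hN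

end FormDomain

end Compactness

/-! ### Calculus of indefinite integrals. -/

section WeakDerivative

/-- `F` is the indefinite integral of the locally integrable function `g`. -/
structure HasWeakDeriv (F g : ℝ → ℝ) : Prop where
  intervalIntegrable : ∀ a b : ℝ, IntervalIntegrable g volume a b
  integral_eq : ∀ a b : ℝ, ∫ t in a..b, g t = F b - F a

namespace HasWeakDeriv

variable {F G g h : ℝ → ℝ}

theorem of_primitive (hg : ∀ a b : ℝ, IntervalIntegrable g volume a b) {c : ℝ}
    (hF : ∀ x, F x = c + ∫ t in (0 : ℝ)..x, g t) : HasWeakDeriv F g :=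
  ⟨hg, fun a b => by
    rw [hF a, hF b, ← intervalIntegral.integral_interval_sub_left (hg 0 b) (hg 0 a)]
    ring⟩

theorem eq_add (hF : HasWeakDeriv F g) (a x : ℝ) : F x = F a + ∫ t in a..x, g t := by
  rw [hF.integral_eq]
  ring

theorem locallyIntegrable (hF : HasWeakDeriv F g) : LocallyIntegrable g := by
  intro x
  refine ⟨Set.Ioo (x - 1) (x + 1), Ioo_mem_nhds (by linarith) (by linarith), ?_⟩
  have := (hF.intervalIntegrable (x - 1) (x + 1)).1
  exact this.mono_set Set.Ioo_subset_Ioc_self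

theorem ae_hasDerivAt (hF : HasWeakDeriv F g) : ∀ᵐ x, HasDerivAt F (g x) x := by
  filter_upwards [LocallyIntegrable.ae_hasDerivAt_integral hF.locallyIntegrable] with x hx
  have h1 := (hx 0).const_add (F 0)
  have h2 : F = fun x => F 0 + ∫ t in (0 : ℝ)..x, g t := funext (hF.eq_add 0)
  rw [h2]
  simpa using h1

theorem absolutelyContinuousOnInterval (hF : HasWeakDeriv F g) (a b : ℝ) :
    AbsolutelyContinuousOnInterval F a b := by
  have h2 : F = (fun x => ∫ t in a..x, g t) + fun _ => F a := funext fun x => by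
    rw [Pi.add_apply, hF.eq_add a x, add_comm]
  rw [h2]
  exact ((hF.intervalIntegrable a b).absolutelyContinuousOnInterval_intervalIntegral (by simp)).add
    (contDiffOn_const (c := F a)).absolutelyContinuousOnInterval

theorem of_absolutelyContinuous (hF : ∀ a b, AbsolutelyContinuousOnInterval F a b) :
    HasWeakDeriv F (deriv F) :=
  ⟨fun a b => (hF a b).intervalIntegrable_deriv, fun a b => (hF a b).integral_deriv_eq_sub⟩

theorem congr_ae (hF : HasWeakDeriv F g) (hgh : g =ᵐ[volume] h) : HasWeakDeriv F h :=
  ⟨fun a b => (hF.intervalIntegrable a b).congr_ae (ae_restrict_of_ae hgh), fun a b => by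
    rw [← hF.integral_eq]
    exact intervalIntegral.integral_congr_ae (hgh.mono fun x hx _ => hx.symm)⟩

theorem mul (hF : HasWeakDeriv F g) (hG : HasWeakDeriv G h) :
    HasWeakDeriv (fun x => F x * G x) (fun x => g x * G x + F x * h x) := by
  refine (of_absolutelyContinuous fun a b => (hF.absolutelyContinuousOnInterval a b).fun_mul
    (hG.absolutelyContinuousOnInterval a b)).congr_ae ?_
  filter_upwards [hF.ae_hasDerivAt, hG.ae_hasDerivAt] with x h1 h2
  exact (h1.mul h2).deriv

theorem of_hasDerivAt (hF : ∀ x, HasDerivAt F (g x) x) (hg : Continuous g) : HasWeakDeriv F g :=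
  ⟨fun a b => hg.intervalIntegrable a b, fun a b =>
    intervalIntegral.integral_eq_sub_of_hasDerivAt (fun x _ => hF x) (hg.intervalIntegrable a b)⟩

theorem continuous (hF : HasWeakDeriv F g) : Continuous F := by
  have h2 : F = fun x => F 0 + ∫ t in (0 : ℝ)..x, g t := funext (hF.eq_add 0)
  rw [h2]
  exact continuous_const.add (intervalIntegral.continuous_primitive hF.intervalIntegrable 0)

theorem hasDerivAt (hF : HasWeakDeriv F g) (hg : Continuous g) (x : ℝ) : HasDerivAt F (g x) x := by
  have h2 : F = fun x => F 0 + ∫ t in (0 : ℝ)..x, g t := funext (hF.eq_add 0)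
  rw [h2]
  exact (intervalIntegral.integral_hasDerivAt_right (hg.intervalIntegrable _ _)
    (hg.stronglyMeasurableAtFilter _ _) hg.continuousAt).const_add _

/-- Integrability of `g` gives `F` limits at `±∞`, and integrability of `F` over half-lines of
infinite measure forces both limits to be zero. -/
theorem integral_eq_zero (hF : HasWeakDeriv F g) (hFi : Integrable F) (hgi : Integrable g) :
    ∫ x, g x = 0 := by
  have hlim : Tendsto (fun x => ∫ t in (0 : ℝ)..x, g t) atTop (nhds (∫ t in Set.Ioi 0, g t)) :=
    intervalIntegral_tendsto_integral_Ioi 0 hgi.integrableOn tendsto_id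
  have hlim' : Tendsto (fun x => ∫ t in x..(0 : ℝ), g t) atBot (nhds (∫ t in Set.Iic 0, g t)) :=
    intervalIntegral_tendsto_integral_Iic 0 hgi.integrableOn tendsto_id
  have h1 : F 0 + ∫ t in Set.Ioi 0, g t = 0 := by
    refine (hFi.integrableAtFilter atTop).eq_zero_of_tendsto (fun s hs => ?_)
      ((hlim.const_add (F 0)).congr fun x => (hF.eq_add 0 x).symm)
    obtain ⟨b, hb⟩ := mem_atTop_sets.1 hs
    exact top_unique ((Real.volume_Ici (a := b)).symm.le.trans (measure_mono hb))
  have h2 : F 0 - ∫ t in Set.Iic 0, g t = 0 := by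
    refine (hFi.integrableAtFilter atBot).eq_zero_of_tendsto (fun s hs => ?_)
      ((hlim'.const_sub (F 0)).congr fun x => by rw [hF.integral_eq]; ring)
    obtain ⟨b, hb⟩ := mem_atBot_sets.1 hs
    exact top_unique ((Real.volume_Iic (a := b)).symm.le.trans (measure_mono hb))
  rw [← intervalIntegral.integral_Iic_add_Ioi (b := 0) hgi.integrableOn hgi.integrableOn]
  linarith

end HasWeakDeriv

theorem FormDomain.hasWeakDeriv (e : FormDomain) :
    HasWeakDeriv (FormDomain.fn e) (FormDomain.der e) :=
  ⟨(FormDomain.der e).intervalIntegrable, fun a b => (FormDomain.fn_sub_fn e a b).symm⟩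

theorem HasWeakDeriv.exists_formDomain {u v : ℝ → ℝ} (h : HasWeakDeriv u v) (hv : MemLp v 2)
    (hw : MemLp (fun x => √(1 + x ^ 2) * u x) 2) :
    ∃ e : FormDomain, FormDomain.fn e = u ∧ FormDomain.der e =ᵐ[volume] v :=
  FormDomain.exists_of_memLp hv (h.eq_add 0) hw

theorem HasWeakDeriv.exists_formDomain_of_hasCompactSupport {u v : ℝ → ℝ} (h : HasWeakDeriv u v)
    (hv : MemLp v 2) (hu : HasCompactSupport u) :
    ∃ e : FormDomain, FormDomain.fn e = u ∧ FormDomain.der e =ᵐ[volume] v := by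
  refine h.exists_formDomain hv (Continuous.memLp_of_hasCompactSupport ?_ hu.mul_left)
  have := h.continuous
  fun_prop

end WeakDerivative

/-! ### The Schrödinger form: symmetry, coercivity, dense domain. -/

section SchrodingerForm

open scoped InnerProductSpace

open FormDomain

theorem FormDomain.integrable_mul_fn_mul_fn {q : ℝ → ℝ} (hq : Integrable q) (e f : FormDomain) :
    Integrable (fun x => q x * (fn e x * fn f x)) := by
  have hc : Continuous (fun x => fn e x * fn f x) := (continuous_fn e).mul (continuous_fn f)
  refine (hq.bdd_mul (c := (2 * ‖e‖) * (2 * ‖f‖)) hc.aestronglyMeasurable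
    (Eventually.of_forall fun x => ?_)).congr (Eventually.of_forall fun x => mul_comm _ _)
  rw [norm_mul]
  exact mul_le_mul (abs_fn_le e x) (abs_fn_le f x) (norm_nonneg _) (by positivity)

/-- The quadratic form of multiplication by an integrable potential. -/
noncomputable def potentialForm {q : ℝ → ℝ} (hq : Integrable q) :
    FormDomain →L[ℝ] FormDomain →L[ℝ] ℝ :=
  LinearMap.mkContinuous₂ (LinearMap.mk₂ ℝ (fun e f => ∫ x, q x * (fn e x * fn f x))
    (fun e e' f => by
      rw [← integral_add (integrable_mul_fn_mul_fn hq _ _) (integrable_mul_fn_mul_fn hq _ _)]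
      congr 1; ext x; rw [fn_add]; ring)
    (fun c e f => by
      rw [smul_eq_mul, ← integral_const_mul]
      congr 1; ext x; rw [fn_smul]; ring)
    (fun e f f' => by
      rw [← integral_add (integrable_mul_fn_mul_fn hq _ _) (integrable_mul_fn_mul_fn hq _ _)]
      congr 1; ext x; rw [fn_add]; ring)
    (fun c e f => by
      rw [smul_eq_mul, ← integral_const_mul]
      congr 1; ext x; rw [fn_smul]; ring))
    (4 * ∫ x, |q x|) (fun e f => by
      have h1 : ‖∫ x, q x * (fn e x * fn f x)‖ ≤ ∫ x, |q x| * ((2 * ‖e‖) * (2 * ‖f‖)) := by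
        refine norm_integral_le_of_norm_le (hq.abs.mul_const _) (Eventually.of_forall fun x => ?_)
        rw [norm_mul, norm_mul]
        exact mul_le_mul_of_nonneg_left (mul_le_mul (abs_fn_le e x) (abs_fn_le f x)
          (norm_nonneg _) (by positivity)) (norm_nonneg _)
      rw [integral_mul_const] at h1
      refine h1.trans (le_of_eq ?_)
      ring)

/-- The pullback of the `L²` inner product under a continuous linear map. -/
noncomputable def pullbackInner (T : FormDomain →L[ℝ] RealL2) :
    FormDomain →L[ℝ] FormDomain →L[ℝ] ℝ :=
  LinearMap.mkContinuous₂ (LinearMap.mk₂ ℝ (fun e f => ⟪T e, T f⟫_ℝ)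
    (fun e e' f => by rw [map_add, inner_add_left])
    (fun c e f => by rw [map_smul, real_inner_smul_left, smul_eq_mul])
    (fun e f f' => by rw [map_add, inner_add_right])
    (fun c e f => by rw [map_smul, real_inner_smul_right, smul_eq_mul]))
    (‖T‖ * ‖T‖) (fun e f => by
      refine (norm_inner_le_norm (𝕜 := ℝ) (T e) (T f)).trans ?_
      calc ‖T e‖ * ‖T f‖ ≤ (‖T‖ * ‖e‖) * (‖T‖ * ‖f‖) :=
            mul_le_mul (T.le_opNorm e) (T.le_opNorm f) (norm_nonneg _) (by positivity)
        _ = _ := by ring)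

/-- A shift making the Schrödinger form with potential `x² + q` coercive. -/
noncomputable def formShift (q : ℝ → ℝ) : ℝ := 8 * (∫ x, |q x|) * ((∫ x, |q x|) + 1)

/-- The form of `-d²/dx² + x² + q + 1 + formShift q`. -/
noncomputable def schrodingerForm {q : ℝ → ℝ} (hq : Integrable q) :
    FormDomain →L[ℝ] FormDomain →L[ℝ] ℝ :=
  pullbackInner der + pullbackInner wgt + potentialForm hq + formShift q • pullbackInner emb

theorem schrodingerForm_apply {q : ℝ → ℝ} (hq : Integrable q) (e f : FormDomain) :
    schrodingerForm hq e f = ⟪der e, der f⟫_ℝ + ⟪wgt e, wgt f⟫_ℝ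
      + (∫ x, q x * (fn e x * fn f x)) + formShift q * ⟪emb e, emb f⟫_ℝ := rfl

theorem schrodingerForm_symm {q : ℝ → ℝ} (hq : Integrable q) (e f : FormDomain) :
    schrodingerForm hq e f = schrodingerForm hq f e := by
  rw [schrodingerForm_apply, schrodingerForm_apply, real_inner_comm (der e),
    real_inner_comm (wgt e), real_inner_comm (emb e)]
  simp_rw [mul_comm (fn e _)]

theorem isCoercive_schrodingerForm {q : ℝ → ℝ} (hq : Integrable q) :
    IsCoercive (schrodingerForm hq) := by
  -- Half of `‖der e‖²` survives the perturbation, and `norm_sq_le` costs a factor `3`.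
  refine ⟨1 / 6, by norm_num, fun e => ?_⟩
  rw [schrodingerForm_apply]
  simp only [real_inner_self_eq_norm_sq]
  set Q := ∫ x, |q x| with hQ
  have hQ0 : 0 ≤ Q := integral_nonneg fun x => abs_nonneg _
  -- Small enough that the derivative term costs at most `1/2 ‖der e‖²`; the remaining coefficient
  -- `Q * (2 / δ)` is exactly `formShift q`.
  set δ : ℝ := 1 / (4 * (Q + 1)) with hδ
  have hδ0 : 0 < δ := by positivity
  have h1 : |∫ x, q x * (fn e x * fn e x)|
      ≤ Q * (2 / δ * ‖emb e‖ ^ 2 + 2 * δ * ‖der e‖ ^ 2) := by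
    rw [hQ, ← integral_mul_const, ← Real.norm_eq_abs]
    refine norm_integral_le_of_norm_le (hq.abs.mul_const _) (Eventually.of_forall fun x => ?_)
    rw [norm_mul, ← sq, norm_pow, Real.norm_eq_abs, Real.norm_eq_abs, sq_abs]
    exact mul_le_mul_of_nonneg_left (fn_sq_le e hδ0 x) (abs_nonneg _)
  have h2 : Q * (2 / δ) = formShift q := by
    rw [hδ, formShift, ← hQ]
    field_simp
    ring
  have h3 : Q * (2 * δ) ≤ 1 / 2 := by
    rw [hδ, mul_one_div, mul_div_assoc', div_le_iff₀ (by positivity)]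
    linarith
  have h4 : Q * (2 * δ) * ‖der e‖ ^ 2 ≤ 1 / 2 * ‖der e‖ ^ 2 := by gcongr
  have h5 := (abs_le.1 h1).1
  have h6 := norm_sq_le e
  rw [← h2]
  nlinarith [sq_nonneg ‖wgt e‖]

/-- The form domain contains all smooth compactly supported functions, and these separate locally
integrable functions. -/
theorem eq_zero_of_inner_emb_eq_zero (x : RealL2) (hx : ∀ e, ⟪x, emb e⟫_ℝ = 0) : x = 0 := by
  have h1 : ∀ᵐ t, x t = 0 := by
    refine ae_eq_zero_of_integral_contDiff_smul_eq_zero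
      ((Lp.memLp x).locallyIntegrable (by norm_num)) fun g hg hgc => ?_
    have hg1 : ContDiff ℝ 1 g := hg.of_le (by exact_mod_cast le_top)
    have hd : HasWeakDeriv g (deriv g) := HasWeakDeriv.of_hasDerivAt
      (fun t => (hg1.differentiable (by norm_num) t).hasDerivAt) (hg1.continuous_deriv le_rfl)
    obtain ⟨e, he, -⟩ := hd.exists_formDomain_of_hasCompactSupport
      ((hg1.continuous_deriv le_rfl).memLp_of_hasCompactSupport hgc.deriv) hgc
    rw [← hx e, RealL2.inner_eq]
    refine integral_congr_ae ?_
    filter_upwards [coeFn_emb e] with t ht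
    rw [ht, he, smul_eq_mul, mul_comm]
  exact (Lp.eq_zero_iff_ae_eq_zero).2 h1

end SchrodingerForm

/-! ### Weak eigenfunctions are classical. -/

section Regularity

open FormDomain

/-- The du Bois-Reymond lemma: a locally square integrable function that annihilates all derivatives
of compactly supported test functions is constant. -/
theorem ae_eq_const_of_annihilates_deriv {w : ℝ → ℝ}
    (hw : ∀ a b : ℝ, IntervalIntegrable w volume a b)
    (hw2 : ∀ a b : ℝ, IntervalIntegrable (fun x => w x ^ 2) volume a b)
    (h : ∀ a b : ℝ, a < b → ∀ t t' : ℝ → ℝ, HasWeakDeriv t t' → MemLp t' 2 →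
      (∀ x, x ∉ Set.Ioo a b → t x = 0) → (∀ x, x ∉ Set.Ioc a b → t' x = 0) →
      ∫ x in a..b, w x * t' x = 0) :
    ∃ m : ℝ, ∀ᵐ x, w x = m := by
  have key : ∀ a b : ℝ, a < b → ∃ m : ℝ, ∀ᵐ x, x ∈ Set.Ioc a b → w x = m := by
    intro a b hab
    -- The test derivative is `w - m` cut off to the interval. Subtracting the mean makes its
    -- primitive vanish at both ends, and the hypothesis becomes `∫ (w - m)² = 0`.
    set m := (∫ x in a..b, w x) / (b - a) with hm
    have hba : b - a ≠ 0 := (sub_pos.2 hab).ne'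
    let t' : ℝ → ℝ := (Set.Ioc a b).indicator fun x => w x - m
    have ht'i : Integrable t' := (integrable_indicator_iff measurableSet_Ioc).2
      ((hw a b).sub intervalIntegrable_const).1
    have hsq : IntervalIntegrable (fun x => (w x - m) ^ 2) volume a b := by
      have h1 : (fun x => (w x - m) ^ 2) = fun x => w x ^ 2 - 2 * m * w x + m ^ 2 := by
        ext x; ring
      rw [h1]
      exact ((hw2 a b).sub ((hw a b).const_mul _)).add intervalIntegrable_const
    have ht'2 : MemLp t' 2 := by
      rw [memLp_two_iff_integrable_sq ht'i.aestronglyMeasurable]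
      have h1 : (fun x => t' x ^ 2) = (Set.Ioc a b).indicator fun x => (w x - m) ^ 2 := by
        ext x
        by_cases hx : x ∈ Set.Ioc a b <;> simp [t', hx]
      rw [h1]
      exact (integrable_indicator_iff measurableSet_Ioc).2 hsq.1
    have hEq : ∫ x in a..b, t' x = ∫ x in a..b, (w x - m) := by
      rw [intervalIntegral.integral_of_le hab.le, intervalIntegral.integral_of_le hab.le]
      exact setIntegral_congr_fun measurableSet_Ioc fun x hx => Set.indicator_of_mem hx _
    have hzero : ∫ x in a..b, t' x = 0 := by
      rw [hEq, intervalIntegral.integral_sub (hw a b) intervalIntegrable_const,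
        intervalIntegral.integral_const, smul_eq_mul, hm]
      field_simp
      ring
    have ht' : ∀ x, x ∉ Set.Ioc a b → t' x = 0 := fun x hx => Set.indicator_of_notMem hx _
    let t : ℝ → ℝ := fun x => ∫ s in a..x, t' s
    have ht : HasWeakDeriv t t' := ⟨fun c d => ht'i.intervalIntegrable, fun c d => by
      rw [intervalIntegral.integral_interval_sub_left ht'i.intervalIntegrable
        ht'i.intervalIntegrable]⟩
    have hout : ∀ c d : ℝ, c ≤ d → (∀ x ∈ Set.Ioc c d, x ∉ Set.Ioc a b) →
        ∫ x in c..d, t' x = 0 := by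
      intro c d hcd hx
      rw [intervalIntegral.integral_of_le hcd, setIntegral_congr_fun measurableSet_Ioc
        (fun x hx' => ht' x (hx x hx')), integral_zero]
    have ht0 : ∀ x, x ∉ Set.Ioo a b → t x = 0 := by
      intro x hx
      rcases le_or_gt x a with h1 | h1
      · change ∫ s in a..x, t' s = 0
        rw [intervalIntegral.integral_symm, hout x a h1 fun y hy hy' => by
          linarith [hy.2, hy'.1], neg_zero]
      · have h2 : b ≤ x := by
          by_contra h2
          exact hx ⟨h1, not_le.1 h2⟩
        have h3 := ht.integral_eq b x
        rw [hout b x h2 fun y hy hy' => by linarith [hy.1, hy'.2]] at h3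
        have h4 : t b = 0 := hzero
        linarith
    have h1 := h a b hab t t' ht ht'2 ht0 ht'
    have h2 : ∫ x in a..b, w x * t' x = ∫ x in a..b, ((w x - m) ^ 2 + m * t' x) := by
      rw [intervalIntegral.integral_of_le hab.le, intervalIntegral.integral_of_le hab.le]
      refine setIntegral_congr_fun measurableSet_Ioc fun x hx => ?_
      simp only [t', Set.indicator_of_mem hx]
      ring
    rw [h2, intervalIntegral.integral_add hsq (ht'i.intervalIntegrable.const_mul _),
      intervalIntegral.integral_const_mul, hzero, mul_zero, add_zero,
      intervalIntegral.integral_of_le hab.le, setIntegral_eq_zero_iff_of_nonneg_ae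
        (Eventually.of_forall fun x => sq_nonneg _) hsq.1] at h1
    refine ⟨m, ?_⟩
    rw [Filter.EventuallyEq, ae_restrict_iff' measurableSet_Ioc] at h1
    filter_upwards [h1] with x hx hxm
    have := hx hxm
    exact sub_eq_zero.1 (pow_eq_zero_iff two_ne_zero |>.1 this)
  obtain ⟨m, hm⟩ := key 0 1 one_pos
  refine ⟨m, ?_⟩
  have h1 : ∀ n : ℕ, ∀ᵐ x, x ∈ Set.Ioc (-(n + 1) : ℝ) (n + 1) → w x = m := by
    intro n
    have hn : (0 : ℝ) ≤ n := n.cast_nonneg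
    obtain ⟨m', hm'⟩ := key (-(n + 1)) (n + 1) (by linarith)
    -- All these intervals contain `(0, 1]`, which has positive measure, so the local constants
    -- agree.
    have h2 : m' = m := by
      by_contra hne
      have h3 : ∀ᵐ x : ℝ, x ∉ Set.Ioc (0 : ℝ) 1 := by
        filter_upwards [hm, hm'] with x h4 h5 hx
        exact hne ((h5 ⟨by linarith [hx.1], by linarith [hx.2]⟩).symm.trans (h4 hx))
      have h4 : volume (Set.Ioc (0 : ℝ) 1) = 0 := by
        rw [measure_eq_zero_iff_ae_notMem]
        exact h3
      simp at h4
    rw [← h2]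
    exact hm'
  filter_upwards [ae_all_iff.2 h1] with x hx
  obtain ⟨n, hn⟩ := exists_nat_ge |x|
  exact hx n ⟨by linarith [neg_abs_le x], by linarith [le_abs_self x]⟩

theorem FormDomain.integrable_fn_mul_fn (e f : FormDomain) :
    Integrable (fun x => fn e x * fn f x) :=
  (memLp_fn e).integrable_mul (memLp_fn f)

theorem FormDomain.wgt_mul_wgt (e f : FormDomain) :
    (fun x => wgt e x * wgt f x) =ᵐ[volume] fun x => (1 + x ^ 2) * (fn e x * fn f x) := by
  filter_upwards [coeFn_wgt e, coeFn_wgt f] with x h1 h2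
  rw [h1, h2]
  have : √(1 + x ^ 2) * √(1 + x ^ 2) = 1 + x ^ 2 := Real.mul_self_sqrt (by positivity)
  linear_combination (fn e x * fn f x) * this

theorem FormDomain.integrable_weight_mul (e f : FormDomain) :
    Integrable (fun x => (1 + x ^ 2) * (fn e x * fn f x)) :=
  ((Lp.memLp (wgt e)).integrable_mul (Lp.memLp (wgt f))).congr (wgt_mul_wgt e f)

theorem FormDomain.integrable_potential {q : ℝ → ℝ} (hq : Integrable q) (μ : ℝ)
    (e f : FormDomain) : Integrable (fun x => (x ^ 2 + q x - μ) * fn e x * fn f x) := by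
  refine (((integrable_weight_mul e f).add (integrable_mul_fn_mul_fn hq e f)).sub
    ((integrable_fn_mul_fn e f).const_mul (1 + μ))).congr (Eventually.of_forall fun x => ?_)
  simp only [Pi.add_apply, Pi.sub_apply]
  ring

/-- The weak form of the eigenvalue equation. -/
theorem mem_formEigenspace_iff {q : ℝ → ℝ} (hq : Integrable q) {μ : ℝ} {e : FormDomain} :
    e ∈ formEigenspace emb (schrodingerForm hq) (μ + 1 + formShift q) ↔
      ∀ f : FormDomain, (∫ x, der e x * der f x)
        + ∫ x, (x ^ 2 + q x - μ) * fn e x * fn f x = 0 := by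
  refine mem_formEigenspace.trans (forall_congr' fun f => ?_)
  have h1 : ∫ x, emb e x * emb f x = ∫ x, fn e x * fn f x := by
    refine integral_congr_ae ?_
    filter_upwards [coeFn_emb e, coeFn_emb f] with x h1 h2
    rw [h1, h2]
  have h2 : ∫ x, (x ^ 2 + q x - μ) * fn e x * fn f x
      = (∫ x, (1 + x ^ 2) * (fn e x * fn f x)) + (∫ x, q x * (fn e x * fn f x))
        - (1 + μ) * ∫ x, fn e x * fn f x := by
    have hi : Integrable (fun x => (1 + x ^ 2) * (fn e x * fn f x) + q x * (fn e x * fn f x)) :=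
      (integrable_weight_mul e f).add (integrable_mul_fn_mul_fn hq e f)
    rw [← integral_const_mul, ← integral_add (integrable_weight_mul e f)
      (integrable_mul_fn_mul_fn hq e f), ← integral_sub hi
      ((integrable_fn_mul_fn e f).const_mul _)]
    congr 1
    ext x
    ring
  rw [schrodingerForm_apply, RealL2.inner_eq, RealL2.inner_eq, RealL2.inner_eq, h1, h2,
    integral_congr_ae (wgt_mul_wgt e f)]
  constructor <;> intro h <;> linarith

/-- A weak eigenfunction is a classical one. -/
theorem fn_mem_schrodingerEigenspace {q : ℝ → ℝ} (hq : Integrable q) {μ : ℝ} {e : FormDomain}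
    (he : e ∈ formEigenspace emb (schrodingerForm hq) (μ + 1 + formShift q)) :
    fn e ∈ schrodingerEigenspace (fun x => x ^ 2 + q x) μ := by
  rw [mem_formEigenspace_iff] at he
  have hce := continuous_fn e
  let g : ℝ → ℝ := fun x => (x ^ 2 + q x - μ) * fn e x
  have hg : ∀ a b : ℝ, IntervalIntegrable g volume a b := fun a b => by
    have h1 : IntervalIntegrable (fun x => x ^ 2 + q x - μ) volume a b :=
      ((Continuous.intervalIntegrable (by fun_prop) a b).add hq.intervalIntegrable).sub
        intervalIntegrable_const
    exact h1.mul_continuousOn hce.continuousOn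
  -- By parts, the weak equation says that `u' - G` annihilates derivatives of test functions. It is
  -- therefore a constant `m`, so `u' = G + m` is absolutely continuous with derivative `g`.
  let G : ℝ → ℝ := fun x => ∫ t in (0 : ℝ)..x, g t
  have hG : HasWeakDeriv G g := HasWeakDeriv.of_primitive hg (c := 0) fun x => by simp [G]
  have hGc := hG.continuous
  have hv := fun a b => (der e).intervalIntegrable a b
  obtain ⟨m, hm⟩ : ∃ m : ℝ, ∀ᵐ x, der e x - G x = m := by
    refine ae_eq_const_of_annihilates_deriv (fun a b => (hv a b).sub (hGc.intervalIntegrable a b))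
      (fun a b => ?_) ?_
    · have h1 : (fun x => (der e x - G x) ^ 2)
          = fun x => der e x ^ 2 - 2 * (der e x * G x) + G x ^ 2 := by
        ext x; ring
      rw [h1]
      exact ((der e).integrable_sq.intervalIntegrable.sub
        (((hv a b).mul_continuousOn hGc.continuousOn).const_mul 2)).add
        ((hGc.pow 2).intervalIntegrable a b)
    · intro a b hab t t' ht ht'2 ht0 ht'0
      obtain ⟨f, hf, hf'⟩ := ht.exists_formDomain_of_hasCompactSupport ht'2
        (HasCompactSupport.intro (isCompact_Icc (a := a) (b := b)) fun x hx =>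
          ht0 x fun hx' => hx (Set.Ioo_subset_Icc_self hx'))
      have h1 := he f
      rw [hf] at h1
      have h2 : ∫ x, der e x * der f x = ∫ x in a..b, der e x * t' x := by
        rw [intervalIntegral.integral_eq_integral_of_support_subset]
        · exact integral_congr_ae (hf'.mono fun x hx => by simp only [hx])
        · intro x hx
          by_contra hx'
          exact hx (by simp [ht'0 x hx'])
      have h3 : ∫ x, (x ^ 2 + q x - μ) * fn e x * t x = ∫ x in a..b, g x * t x := by
        rw [intervalIntegral.integral_eq_integral_of_support_subset]
        intro x hx
        by_contra hx'
        exact hx (by simp [ht0 x fun h => hx' (Set.Ioo_subset_Ioc_self h)])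
      rw [h2, h3] at h1
      have h4 := (hG.mul ht).integral_eq a b
      rw [ht0 a (by simp), ht0 b (by simp), mul_zero, mul_zero, sub_zero,
        intervalIntegral.integral_add ((hg a b).mul_continuousOn ht.continuous.continuousOn)
        ((ht.intervalIntegrable a b).continuousOn_mul hGc.continuousOn)] at h4
      have h5 : IntervalIntegrable (fun x => der e x * t' x) volume a b :=
        ((Lp.memLp (der e)).integrable_mul ht'2).intervalIntegrable
      simp_rw [sub_mul]
      rw [intervalIntegral.integral_sub h5
        ((ht.intervalIntegrable a b).continuousOn_mul hGc.continuousOn)]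
      linarith
  have hd : HasWeakDeriv (fn e) (fun x => G x + m) :=
    (FormDomain.hasWeakDeriv e).congr_ae (hm.mono fun x hx => by linarith)
  have hderiv : ∀ x, HasDerivAt (fn e) (G x + m) x := hd.hasDerivAt (by fun_prop)
  have hderiv' : deriv (fn e) = fun x => G x + m := funext fun x => (hderiv x).deriv
  have hGm : HasWeakDeriv (fun x => G x + m) g :=
    HasWeakDeriv.of_primitive hg (c := m) fun x => by rw [add_comm]
  refine ⟨fun x => (hderiv x).differentiableAt, fun a b => ?_, memLp_fn e, ?_⟩
  · rw [hderiv']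
    exact hGm.absolutelyContinuousOnInterval a b
  · rw [hderiv']
    filter_upwards [hGm.ae_hasDerivAt] with x hx
    rw [hx.deriv]
    simp only [g]
    ring

end Regularity

/-! ### Classical eigenfunctions have finite energy. -/

section EnergyEstimate

open FormDomain

/-- The localization identity for a solution of `u'' = p u` and a cutoff `c` vanishing at the end
points. -/
theorem localization_identity {u d p c c' : ℝ → ℝ} (hu : HasWeakDeriv u d)
    (hd : HasWeakDeriv d fun x => p x * u x) (hc : ∀ x, HasDerivAt c (c' x) x) (hc' : Continuous c')
    (hp : ∀ a b : ℝ, IntervalIntegrable p volume a b) {a b : ℝ} (ha : c a = 0) (hb : c b = 0) :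
    (∫ x in a..b, (c' x * u x + c x * d x) ^ 2) + ∫ x in a..b, p x * (c x * u x) ^ 2
      = ∫ x in a..b, c' x ^ 2 * u x ^ 2 := by
  have hcw : HasWeakDeriv c c' := HasWeakDeriv.of_hasDerivAt hc hc'
  have huc := hu.continuous
  have hdc := hd.continuous
  have hcc := hcw.continuous
  -- The two sides differ by the integral of `(c² u u')'`, whose boundary terms vanish with `c`.
  have hF := (hcw.mul (hcw.mul hu)).mul hd
  have h1 := hF.integral_eq a b
  rw [ha, hb] at h1
  simp only [zero_mul, sub_self] at h1
  rw [← intervalIntegral.integral_add (Continuous.intervalIntegrable (by fun_prop) _ _)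
    ((hp a b).mul_continuousOn (by fun_prop)), ← sub_eq_zero, ← intervalIntegral.integral_sub
    ((Continuous.intervalIntegrable (by fun_prop) _ _).add
      ((hp a b).mul_continuousOn (by fun_prop))) (Continuous.intervalIntegrable (by fun_prop) _ _),
    ← h1]
  congr 1
  ext x
  ring

/-- A function vanishing at the left end point is bounded in terms of its `L²` norm and, with a
small constant, that of its derivative. -/
theorem sq_le_of_eq_zero_left {y y' : ℝ → ℝ} (hy : HasWeakDeriv y y') (hy' : Continuous y')
    {a b : ℝ} (ha : y a = 0) {ε : ℝ} (hε : 0 < ε) {x : ℝ} (hx : x ∈ Set.Icc a b) :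
    y x ^ 2 ≤ 1 / ε * (∫ t in a..b, y t ^ 2) + ε * ∫ t in a..b, y' t ^ 2 := by
  have hyc := hy.continuous
  -- `y(x)²` is the integral of `2 y y'` from `a`, bounded by the weighted inequality `2 y y' ≤ y²/ε
  -- + ε y'²`.
  have h1 := (hy.mul hy).integral_eq a x
  rw [ha, mul_zero, sub_zero] at h1
  have h2 : ∫ t in a..x, (y' t * y t + y t * y' t)
      ≤ ∫ t in a..x, (1 / ε * y t ^ 2 + ε * y' t ^ 2) := by
    refine intervalIntegral.integral_mono_on hx.1 (Continuous.intervalIntegrable (by fun_prop) _ _)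
      (Continuous.intervalIntegrable (by fun_prop) _ _) fun t _ => ?_
    have h3 : 0 ≤ 1 / ε * (y t - ε * y' t) ^ 2 := by positivity
    have h4 : 1 / ε * (y t - ε * y' t) ^ 2
        = 1 / ε * y t ^ 2 + ε * y' t ^ 2 - (y' t * y t + y t * y' t) := by
      field_simp
      ring
    linarith
  have h5 : ∫ t in a..x, (1 / ε * y t ^ 2 + ε * y' t ^ 2)
      ≤ ∫ t in a..b, (1 / ε * y t ^ 2 + ε * y' t ^ 2) :=
    intervalIntegral.integral_mono_interval le_rfl hx.1 hx.2
      (Eventually.of_forall fun t => by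
        change 0 ≤ 1 / ε * y t ^ 2 + ε * y' t ^ 2
        positivity) (Continuous.intervalIntegrable (by fun_prop) _ _)
  rw [intervalIntegral.integral_add (Continuous.intervalIntegrable (by fun_prop) a b)
    (Continuous.intervalIntegrable (by fun_prop) _ _), intervalIntegral.integral_const_mul,
    intervalIntegral.integral_const_mul] at h5
  linarith

/-- The energy of a localized solution of `u'' = (x² + q - μ) u` is controlled by the `L²` norm of
the solution. Here `y = c u` with a cutoff `c` and `y' = c' u + c d`. -/
theorem localized_energy_le {q y y' : ℝ → ℝ} {μ R U : ℝ} (hq : Integrable q) (hU0 : 0 ≤ U)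
    (hy : HasWeakDeriv y y') (hy'c : Continuous y') (hle : -R ≤ R) (hy0 : y (-R) = 0)
    (hyU : ∫ x in (-R)..R, y x ^ 2 ≤ U)
    (hid : (∫ x in (-R)..R, y' x ^ 2) + ∫ x in (-R)..R, (x ^ 2 + q x - μ) * y x ^ 2 ≤ 4 * U) :
    (∫ x in (-R)..R, y' x ^ 2) / 2 + ∫ x in (-R)..R, x ^ 2 * y x ^ 2
      ≤ (4 + |μ| + 2 * (∫ x, |q x|) * ((∫ x, |q x|) + 1)) * U := by
  set Q := ∫ x, |q x| with hQ
  have hQ0 : 0 ≤ Q := integral_nonneg fun x => abs_nonneg _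
  have hqi : ∀ a b : ℝ, IntervalIntegrable q volume a b := fun a b => hq.intervalIntegrable
  have hyc := hy.continuous
  set A := ∫ x in (-R)..R, y' x ^ 2 with hA
  set X := ∫ x in (-R)..R, x ^ 2 * y x ^ 2 with hX
  have hA0 : 0 ≤ A := intervalIntegral.integral_nonneg hle fun x _ => sq_nonneg _
  have hX0 : 0 ≤ X := intervalIntegral.integral_nonneg hle fun x _ => by positivity
  have hsplit : ∫ x in (-R)..R, (x ^ 2 + q x - μ) * y x ^ 2
      = X + (∫ x in (-R)..R, q x * y x ^ 2) - μ * ∫ x in (-R)..R, y x ^ 2 := by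
    have i1 : IntervalIntegrable (fun x => x ^ 2 * y x ^ 2) volume (-R) R :=
      Continuous.intervalIntegrable (by fun_prop) _ _
    have i2 : IntervalIntegrable (fun x => q x * y x ^ 2) volume (-R) R :=
      (hqi _ _).mul_continuousOn (by fun_prop)
    have i3 : IntervalIntegrable (fun x => μ * y x ^ 2) volume (-R) R :=
      Continuous.intervalIntegrable (by fun_prop) _ _
    rw [hX, ← intervalIntegral.integral_const_mul, ← intervalIntegral.integral_add i1 i2,
      ← intervalIntegral.integral_sub (i1.add i2) i3]
    congr 1
    ext x
    ring
  -- Chosen so that `Q ε ≤ 1/2`: half of the derivative term absorbs the contribution of `q`.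
  set ε : ℝ := 1 / (2 * (Q + 1)) with hε
  have hε0 : 0 < ε := by positivity
  have hqy : |∫ x in (-R)..R, q x * y x ^ 2| ≤ Q * (1 / ε * U + ε * A) := by
    have h1 : ‖∫ x in (-R)..R, q x * y x ^ 2‖
        ≤ ∫ x in (-R)..R, |q x| * (1 / ε * U + ε * A) := by
      refine intervalIntegral.norm_integral_le_of_norm_le hle (ae_of_all _ fun x hx => ?_)
        ((hqi _ _).abs.mul_const _)
      rw [norm_mul, norm_pow, Real.norm_eq_abs, Real.norm_eq_abs, sq_abs]
      refine mul_le_mul_of_nonneg_left ?_ (abs_nonneg _)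
      have h2 := sq_le_of_eq_zero_left hy hy'c (a := -R) (b := R) hy0 hε0
        (Set.Ioc_subset_Icc_self hx)
      have h3 : 1 / ε * (∫ t in (-R)..R, y t ^ 2) ≤ 1 / ε * U := by gcongr
      linarith
    rw [intervalIntegral.integral_mul_const] at h1
    refine h1.trans (mul_le_mul_of_nonneg_right ?_ (by positivity))
    exact intervalIntegral_le_integral_of_nonneg hq.abs (fun x => abs_nonneg _) hle
  have hQε : Q * ε ≤ 1 / 2 := by
    rw [hε, mul_one_div, div_le_iff₀ (by positivity)]
    linarith
  have hQε' : Q * (1 / ε * U) = 2 * Q * (Q + 1) * U := by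
    rw [hε]
    field_simp
  have hμ : μ * ∫ x in (-R)..R, y x ^ 2 ≤ |μ| * U := by
    have h1 : 0 ≤ ∫ x in (-R)..R, y x ^ 2 :=
      intervalIntegral.integral_nonneg hle fun x _ => sq_nonneg _
    exact (mul_le_mul_of_nonneg_right (le_abs_self μ) h1).trans
      (mul_le_mul_of_nonneg_left hyU (abs_nonneg μ))
  have h1 : A + (X + (∫ x in (-R)..R, q x * y x ^ 2) - μ * ∫ x in (-R)..R, y x ^ 2)
      ≤ 4 * U := by
    rw [← hsplit]
    exact hid
  have h2 := (abs_le.1 hqy).1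
  have h3 : Q * ε * A ≤ 1 / 2 * A := by gcongr
  have h4 : Q * (1 / ε * U + ε * A) = 2 * Q * (Q + 1) * U + Q * ε * A := by
    rw [mul_add, hQε']
    ring
  rw [h4] at h2
  linarith

/-- Square integrable solutions of `u'' = (x² + q - μ) u` have finite energy: a bound on bounded
intervals. -/
theorem exists_energy_bound {q u d : ℝ → ℝ} {μ : ℝ} (hq : Integrable q) (hu : HasWeakDeriv u d)
    (hd : HasWeakDeriv d fun x => (x ^ 2 + q x - μ) * u x) (hu2 : MemLp u 2) :
    ∃ C, ∀ r : ℝ, 1 ≤ r → ∫ x in (-r)..r, d x ^ 2 ≤ C ∧ ∫ x in (-r)..r, x ^ 2 * u x ^ 2 ≤ C := by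
  set Q := ∫ x, |q x| with hQ
  set U := ∫ x, u x ^ 2 with hU
  have hQ0 : 0 ≤ Q := integral_nonneg fun x => abs_nonneg _
  have hU0 : 0 ≤ U := integral_nonneg fun x => sq_nonneg _
  have huc := hu.continuous
  have hdc := hd.continuous
  set K := (4 + |μ| + 2 * Q * (Q + 1)) * U with hK
  have hK0 : 0 ≤ K := by positivity
  -- On `[-r, r]`, `d² ≤ 4 y'² + 4 c'² u²`; the energy bound gives `∫ y'² ≤ 2K` and the cutoff gives
  -- `∫ c'² u² ≤ 4U`. None of these constants depends on `r`.
  refine ⟨8 * K + 16 * U, fun r hr => ?_⟩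
  set R := 2 * r with hR
  have hRpos : 0 < R := by linarith
  -- A polynomial cutoff suffices: it vanishes at `±R`, is at least `3/4` on `[-r, r]` as `R = 2r`,
  -- and its slope is bounded uniformly in `r ≥ 1`.
  let c : ℝ → ℝ := fun x => 1 - x ^ 2 / R ^ 2
  let c' : ℝ → ℝ := fun x => -(2 * x / R ^ 2)
  have hc : ∀ x, HasDerivAt c (c' x) x := fun x => by
    refine (((hasDerivAt_pow 2 x).div_const (R ^ 2)).const_sub 1).congr_deriv ?_
    simp [c']
  have hcc : Continuous c := by fun_prop
  have hc'c : Continuous c' := by fun_prop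
  have hcw : HasWeakDeriv c c' := HasWeakDeriv.of_hasDerivAt hc hc'c
  have hcR : c R = 0 := by simp [c, hRpos.ne']
  have hcR' : c (-R) = 0 := by simp [c, hRpos.ne']
  have hqi : ∀ a b : ℝ, IntervalIntegrable q volume a b := fun a b => hq.intervalIntegrable
  have hid := localization_identity (p := fun x => x ^ 2 + q x - μ) hu hd hc hc'c
    (fun a b => ((Continuous.intervalIntegrable (by fun_prop) a b).add (hqi a b)).sub
      intervalIntegrable_const) hcR' hcR
  let y : ℝ → ℝ := fun x => c x * u x
  let y' : ℝ → ℝ := fun x => c' x * u x + c x * d x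
  have hy : HasWeakDeriv y y' := hcw.mul hu
  have hyc : Continuous y := hy.continuous
  have hy'c : Continuous y' := by fun_prop
  have hle : -R ≤ R := by linarith
  have hsq : ∀ x ∈ Set.Icc (-R) R, x ^ 2 ≤ R ^ 2 := fun x hx => by
    nlinarith [hx.1, hx.2]
  have hUb : ∫ x in (-R)..R, u x ^ 2 ≤ U :=
    intervalIntegral_le_integral_of_nonneg hu2.integrable_sq (fun x => sq_nonneg _) hle
  have hyU : ∫ x in (-R)..R, y x ^ 2 ≤ U := by
    refine le_trans (intervalIntegral.integral_mono_on hle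
      (Continuous.intervalIntegrable (by fun_prop) _ _)
      (Continuous.intervalIntegrable (by fun_prop) _ _) fun x hx => ?_) hUb
    have h1 : x ^ 2 / R ^ 2 ≤ 1 := div_le_one_of_le₀ (hsq x hx) (by positivity)
    have h2 : 0 ≤ x ^ 2 / R ^ 2 := by positivity
    have h3 : c x ^ 2 ≤ 1 := by
      simp only [c]
      nlinarith
    change (c x * u x) ^ 2 ≤ u x ^ 2
    rw [mul_pow]
    exact mul_le_of_le_one_left (sq_nonneg _) h3
  have hc'b : ∀ x ∈ Set.Icc (-R) R, c' x ^ 2 ≤ 4 := fun x hx => by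
    have h1 : c' x ^ 2 = 4 * (x ^ 2 / R ^ 2) / R ^ 2 := by
      simp only [c']
      field_simp
      ring
    have h2 : x ^ 2 / R ^ 2 ≤ 1 := div_le_one_of_le₀ (hsq x hx) (by positivity)
    rw [h1, div_le_iff₀ (by positivity)]
    nlinarith
  have hc'U : ∫ x in (-R)..R, c' x ^ 2 * u x ^ 2 ≤ 4 * U := by
    refine le_trans (intervalIntegral.integral_mono_on hle
      (Continuous.intervalIntegrable (by fun_prop) _ _)
      (Continuous.intervalIntegrable (by fun_prop) _ _) (g := fun x => 4 * u x ^ 2) fun x hx =>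
        mul_le_mul_of_nonneg_right (hc'b x hx) (sq_nonneg _)) ?_
    rw [intervalIntegral.integral_const_mul]
    linarith
  have hK' := localized_energy_le hq hU0 hy hy'c hle (by simp [y, hcR']) hyU (μ := μ)
    (by rw [← hid] at hc'U; exact hc'U)
  rw [← hQ, ← hK] at hK'
  set A := ∫ x in (-R)..R, y' x ^ 2 with hA
  set X := ∫ x in (-R)..R, x ^ 2 * y x ^ 2 with hX
  have hA0 : 0 ≤ A := intervalIntegral.integral_nonneg hle fun x _ => sq_nonneg _
  have hX0 : 0 ≤ X := intervalIntegral.integral_nonneg hle fun x _ => by positivity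
  have hrle : -r ≤ r := by linarith
  have hsub : ∀ f : ℝ → ℝ, Continuous f → (∀ x, 0 ≤ f x) →
      ∫ x in (-r)..r, f x ≤ ∫ x in (-R)..R, f x := fun f hf h0 =>
    intervalIntegral.integral_mono_interval (by linarith) hrle (by linarith)
      (Eventually.of_forall h0) (hf.intervalIntegrable _ _)
  have hclow : ∀ x ∈ Set.Icc (-r) r, 1 / 2 ≤ c x ^ 2 := fun x hx => by
    have h1 : x ^ 2 / R ^ 2 ≤ 1 / 4 := by
      rw [div_le_iff₀ (by positivity), hR]
      nlinarith [hx.1, hx.2]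
    simp only [c]
    nlinarith
  have i1 : IntervalIntegrable (fun x => 4 * y' x ^ 2) volume (-R) R :=
    Continuous.intervalIntegrable (by fun_prop) _ _
  have i2 : IntervalIntegrable (fun x => 4 * (c' x ^ 2 * u x ^ 2)) volume (-R) R :=
    Continuous.intervalIntegrable (by fun_prop) _ _
  have e1 : ∫ x in (-R)..R, (4 * y' x ^ 2 + 4 * (c' x ^ 2 * u x ^ 2))
      = 4 * A + 4 * ∫ x in (-R)..R, c' x ^ 2 * u x ^ 2 := by
    rw [intervalIntegral.integral_add i1 i2, intervalIntegral.integral_const_mul,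
      intervalIntegral.integral_const_mul]
  have e2 : ∫ x in (-R)..R, 2 * (x ^ 2 * y x ^ 2) = 2 * X :=
    intervalIntegral.integral_const_mul _ _
  clear_value A X K U Q
  constructor
  · have h1 : ∫ x in (-r)..r, d x ^ 2
        ≤ ∫ x in (-r)..r, (4 * y' x ^ 2 + 4 * (c' x ^ 2 * u x ^ 2)) := by
      refine intervalIntegral.integral_mono_on hrle
        (Continuous.intervalIntegrable (by fun_prop) _ _)
        (Continuous.intervalIntegrable (by fun_prop) _ _) fun x hx => ?_
      have h2 := hclow x hx
      have h3 : c x ^ 2 * d x ^ 2 ≤ 2 * y' x ^ 2 + 2 * (c' x ^ 2 * u x ^ 2) := by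
        simp only [y']
        nlinarith [sq_nonneg (2 * (c' x * u x) + c x * d x)]
      nlinarith [sq_nonneg (d x)]
    have h2 := hsub (fun x => 4 * y' x ^ 2 + 4 * (c' x ^ 2 * u x ^ 2)) (by fun_prop)
      (fun x => by positivity)
    rw [e1] at h2
    linarith
  · have h1 : ∫ x in (-r)..r, x ^ 2 * u x ^ 2 ≤ ∫ x in (-r)..r, 2 * (x ^ 2 * y x ^ 2) := by
      refine intervalIntegral.integral_mono_on hrle
        (Continuous.intervalIntegrable (by fun_prop) _ _)
        (Continuous.intervalIntegrable (by fun_prop) _ _) fun x hx => ?_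
      have h2 := hclow x hx
      have h3 : 0 ≤ x ^ 2 * u x ^ 2 := by positivity
      simp only [y]
      nlinarith
    have h2 := hsub (fun x => 2 * (x ^ 2 * y x ^ 2)) (by fun_prop) (fun x => by positivity)
    rw [e2] at h2
    linarith

theorem integrable_of_bounded_on_intervals {f : ℝ → ℝ} (hf : Continuous f) (h0 : ∀ x, 0 ≤ f x)
    {C : ℝ} (hC : ∀ r : ℝ, 1 ≤ r → ∫ x in (-r)..r, f x ≤ C) : Integrable f := by
  refine integrable_of_intervalIntegral_norm_bounded (l := atTop) (a := fun r : ℝ => -r) (b := id) C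
    (fun r => (hf.intervalIntegrable (-r) r).1) tendsto_neg_atTop_atBot tendsto_id ?_
  filter_upwards [eventually_ge_atTop 1] with r hr
  simp_rw [Real.norm_of_nonneg (h0 _)]
  exact hC r hr

/-- A classical square integrable eigenfunction lies in the form domain and is a weak
eigenfunction. -/
theorem exists_fn_eq_of_mem_schrodingerEigenspace {q : ℝ → ℝ} (hq : Integrable q) {μ : ℝ}
    {u : ℝ → ℝ} (hu : u ∈ schrodingerEigenspace (fun x => x ^ 2 + q x) μ) :
    ∃ e ∈ formEigenspace emb (schrodingerForm hq) (μ + 1 + formShift q), fn e = u := by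
  obtain ⟨hdiff, hac, hu2, hode⟩ := hu
  have hd : HasWeakDeriv (deriv u) fun x => (x ^ 2 + q x - μ) * u x :=
    (HasWeakDeriv.of_absolutelyContinuous hac).congr_ae (hode.mono fun x hx => by
      simp only at hx
      linarith)
  have hdc := hd.continuous
  have hw : HasWeakDeriv u (deriv u) :=
    HasWeakDeriv.of_hasDerivAt (fun x => (hdiff x).hasDerivAt) hdc
  have huc := hw.continuous
  obtain ⟨C, hC⟩ := exists_energy_bound hq hw hd hu2
  have hd2 : MemLp (deriv u) 2 := by
    rw [memLp_two_iff_integrable_sq hdc.aestronglyMeasurable]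
    exact integrable_of_bounded_on_intervals (by fun_prop) (fun x => sq_nonneg _)
      fun r hr => (hC r hr).1
  have hwt : MemLp (fun x => √(1 + x ^ 2) * u x) 2 := by
    rw [memLp_two_iff_integrable_sq (Continuous.aestronglyMeasurable (by fun_prop))]
    have h1 : Integrable fun x => x ^ 2 * u x ^ 2 :=
      integrable_of_bounded_on_intervals (by fun_prop) (fun x => by positivity)
        fun r hr => (hC r hr).2
    refine (hu2.integrable_sq.add h1).congr (Eventually.of_forall fun x => ?_)
    simp only [Pi.add_apply]
    rw [mul_pow, Real.sq_sqrt (by positivity)]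
    ring
  obtain ⟨e, he, he'⟩ := hw.exists_formDomain hd2 hwt
  refine ⟨e, ?_, he⟩
  rw [mem_formEigenspace_iff]
  intro f
  -- The weak equation is the vanishing of the integral of `(u' f)'`; the energy bound makes every
  -- term integrable over the line, so no boundary term survives.
  have hF := hd.mul (FormDomain.hasWeakDeriv f)
  have i1 : Integrable fun x => deriv u x * fn f x := hd2.integrable_mul (memLp_fn f)
  have i2 : Integrable fun x => (x ^ 2 + q x - μ) * u x * fn f x := by
    rw [← he]
    exact integrable_potential hq μ e f
  have i3 : Integrable fun x => deriv u x * der f x := hd2.integrable_mul (Lp.memLp (der f))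
  have h1 := hF.integral_eq_zero i1 (i2.add i3)
  rw [integral_add i2 i3] at h1
  rw [he, integral_congr_ae (he'.mono fun x hx => by
    rw [hx]), add_comm]
  exact h1

/-- The weak and classical eigenspaces are isomorphic. -/
noncomputable def formEigenspaceEquivSchrodinger {q : ℝ → ℝ} (hq : Integrable q) (μ : ℝ) :
    formEigenspace emb (schrodingerForm hq) (μ + 1 + formShift q)
      ≃ₗ[ℝ] schrodingerEigenspace (fun x => x ^ 2 + q x) μ :=
  LinearEquiv.ofBijective
    { toFun := fun e => ⟨fn e.1, fn_mem_schrodingerEigenspace hq e.2⟩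
      map_add' := fun e f => Subtype.ext (funext fun x => fn_add e.1 f.1 x)
      map_smul' := fun c e => Subtype.ext (funext fun x => fn_smul c e.1 x) }
    ⟨fun e f hef => by
      have h1 : fn e.1 = fn f.1 := congrArg Subtype.val hef
      have h2 : emb (e.1 - f.1) = 0 := by
        rw [Lp.eq_zero_iff_ae_eq_zero]
        filter_upwards [coeFn_emb (e.1 - f.1)] with x hx
        rw [hx, fn_sub, h1, sub_self, Pi.zero_apply]
      exact Subtype.ext (sub_eq_zero.1 (formEigenspace_injOn (isCoercive_schrodingerForm hq)
        (Submodule.sub_mem _ e.2 f.2) h2)),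
    fun u => by
      obtain ⟨e, he, heu⟩ := exists_fn_eq_of_mem_schrodingerEigenspace hq u.2
      exact ⟨⟨e, he⟩, Subtype.ext heu⟩⟩

theorem rank_schrodingerEigenspace {q : ℝ → ℝ} (hq : Integrable q) (μ : ℝ) :
    Module.rank ℝ (schrodingerEigenspace (fun x => x ^ 2 + q x) μ)
      = Module.rank ℝ (formEigenspace emb (schrodingerForm hq) (μ + 1 + formShift q)) :=
  (formEigenspaceEquivSchrodinger hq μ).rank_eq.symm

end EnergyEstimate

/-! ### Hermite functions as trial vectors. -/

section TrialFunctions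

open scoped InnerProductSpace

open FormDomain

theorem hasWeakDeriv_hermiteFn (k : ℕ) : HasWeakDeriv (hermiteFn k) (hermiteFnDeriv k) :=
  HasWeakDeriv.of_hasDerivAt (hasDerivAt_hermiteFn k) (by unfold hermiteFnDeriv; fun_prop)

theorem memLp_hermiteFnDeriv (k : ℕ) : MemLp (hermiteFnDeriv k) 2 :=
  (memLp_exp_half_mul_eval _).const_mul _

theorem memLp_hermiteFn (k : ℕ) : MemLp (hermiteFn k) 2 :=
  (memLp_exp_half_mul_eval _).const_mul _

theorem memLp_mul_hermiteFn (k : ℕ) : MemLp (fun x => x * hermiteFn k x) 2 := by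
  refine (((memLp_exp_half_mul_eval (X * hermiteH k)).const_mul
    (√(√Real.pi * 2 ^ k * k !))⁻¹).ae_eq (Eventually.of_forall fun x => ?_))
  simp [hermiteFn]
  ring

theorem exists_formDomain_hermiteFn (k : ℕ) :
    ∃ e : FormDomain, fn e = hermiteFn k ∧ der e =ᵐ[volume] hermiteFnDeriv k := by
  have hc := (hasWeakDeriv_hermiteFn k).continuous
  refine (hasWeakDeriv_hermiteFn k).exists_formDomain (memLp_hermiteFnDeriv k) ?_
  rw [memLp_two_iff_integrable_sq (Continuous.aestronglyMeasurable (by fun_prop))]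
  refine ((memLp_hermiteFn k).integrable_sq.add (memLp_mul_hermiteFn k).integrable_sq).congr
    (Eventually.of_forall fun x => ?_)
  have h : √(1 + x ^ 2) ^ 2 = 1 + x ^ 2 := Real.sq_sqrt (by positivity)
  simp only [Pi.add_apply]
  linear_combination -hermiteFn k x ^ 2 * h

/-- The Hermite functions as elements of the form domain. -/
noncomputable def hermiteTrial (k : ℕ) : FormDomain := (exists_formDomain_hermiteFn k).choose

theorem fn_hermiteTrial (k : ℕ) : fn (hermiteTrial k) = hermiteFn k :=
  (exists_formDomain_hermiteFn k).choose_spec.1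

theorem der_hermiteTrial (k : ℕ) : der (hermiteTrial k) =ᵐ[volume] hermiteFnDeriv k :=
  (exists_formDomain_hermiteFn k).choose_spec.2

theorem inner_emb_eq (e f : FormDomain) : ⟪emb e, emb f⟫_ℝ = ∫ x, fn e x * fn f x := by
  rw [RealL2.inner_eq]
  refine integral_congr_ae ?_
  filter_upwards [coeFn_emb e, coeFn_emb f] with x h1 h2
  rw [h1, h2]

theorem orthonormal_emb_hermiteTrial : Orthonormal ℝ fun k => emb (hermiteTrial k) := by
  rw [orthonormal_iff_ite]
  intro m n
  rw [inner_emb_eq, fn_hermiteTrial, fn_hermiteTrial, integral_hermiteFn_mul]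

theorem schrodingerForm_hermiteTrial {q : ℝ → ℝ} (hq : Integrable q) (k : ℕ) :
    schrodingerForm hq (hermiteTrial k) (hermiteTrial k)
      = harmonicEigenvalue k + 1 + formShift q
        + ∫ x, q x * (hermiteFn k x * hermiteFn k x) := by
  have h1 : ⟪emb (hermiteTrial k), emb (hermiteTrial k)⟫_ℝ = 1 := by
    rw [inner_emb_eq, fn_hermiteTrial, integral_hermiteFn_mul, if_pos rfl]
  have h2 : ⟪der (hermiteTrial k), der (hermiteTrial k)⟫_ℝ = ∫ x, hermiteFnDeriv k x ^ 2 := by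
    rw [RealL2.inner_eq]
    refine integral_congr_ae ?_
    filter_upwards [der_hermiteTrial k] with x hx
    rw [hx, sq]
  have i1 : Integrable fun x => hermiteFn k x * hermiteFn k x :=
    (memLp_hermiteFn k).integrable_mul (memLp_hermiteFn k)
  have i2 : Integrable fun x => x ^ 2 * hermiteFn k x ^ 2 :=
    (memLp_mul_hermiteFn k).integrable_sq.congr (Eventually.of_forall fun x => mul_pow _ _ _)
  have h3 : ⟪wgt (hermiteTrial k), wgt (hermiteTrial k)⟫_ℝ
      = (∫ x, hermiteFn k x * hermiteFn k x) + ∫ x, x ^ 2 * hermiteFn k x ^ 2 := by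
    rw [RealL2.inner_eq, integral_congr_ae (wgt_mul_wgt _ _), fn_hermiteTrial,
      ← integral_add i1 i2]
    congr 1
    ext x
    ring
  have h4 := integral_hermiteFn_energy k
  rw [integral_add (memLp_hermiteFnDeriv k).integrable_sq i2] at h4
  have h5 := integral_hermiteFn_mul k k
  rw [if_pos rfl] at h5
  rw [schrodingerForm_apply, h1, h2, h3, h5, fn_hermiteTrial, harmonicEigenvalue, ← h4]
  ring

theorem not_finiteDimensional_realL2 : ¬ FiniteDimensional ℝ RealL2 := fun _ =>
  not_finite_iff_infinite.2 (inferInstance : Infinite ℕ)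
    (orthonormal_emb_hermiteTrial.linearIndependent.finite)

end TrialFunctions

/-! ### The eigenvalue sequence and the inequality. -/

theorem corollary5p3 (q : ℝ → ℝ) (hq : Integrable q volume) :
    (∃ l : ℕ → ℝ, IsEigenvalueSequence (fun x => x ^ 2 + q x) l ∧ Tendsto l atTop atTop) ∧
    ∀ l : ℕ → ℝ, IsEigenvalueSequence (fun x => x ^ 2 + q x) l →
      ∀ n : ℕ,
        ∑ k ∈ Finset.range (n + 1),
            (l k - harmonicEigenvalue k
              - 1 / (Real.pi * √(harmonicEigenvalue k)) * ∫ x : ℝ, q x) ≤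
          ∑ k ∈ Finset.range (n + 1),
            ((2 : ℝ) ^ k * ((2 * k)! : ℝ) / (k ! : ℝ) * ((n + 1).choose (k + 1) : ℝ)
                * hermiteCoeff q (2 * k)
              - 1 / (Real.pi * √(harmonicEigenvalue k)) * ∫ x : ℝ, q x) := by
  have hB := isCoercive_schrodingerForm hq
  have hJ := FormDomain.isCompactOperator_emb
  have hs := schrodingerForm_symm hq
  have hd := eq_zero_of_inner_emb_eq_zero
  constructor
  · obtain ⟨l, hl, ht, hm⟩ := exists_form_eigenvalue_sequence hJ hB hs
      hd not_finiteDimensional_realL2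
    -- The form belongs to `H + 1 + formShift q`, the `1` coming from the weight `1 + x²`, so its
    -- eigenvalues are shifted back.
    refine ⟨fun k => l k - (1 + formShift q), ⟨fun a b hab => sub_le_sub_right (hl hab) _,
      fun μ => ?_⟩, tendsto_atTop_add_const_right _ _ ht⟩
    rw [rank_schrodingerEigenspace hq, ← hm]
    refine Cardinal.mk_congr (Equiv.subtypeEquivRight fun k => ?_)
    constructor <;> intro h <;> linarith
  · intro l hl n
    have hmono : Monotone fun k => l k + (1 + formShift q) := fun a b hab =>
      add_le_add_left (hl.monotone hab) _
    have hm : ∀ μ, Cardinal.mk {k : ℕ // l k + (1 + formShift q) = μ} = Module.rank ℝ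
        (formEigenspace FormDomain.emb (schrodingerForm hq) μ) := by
      intro μ
      have h2 := hl.multiplicity (μ - (1 + formShift q))
      rw [rank_schrodingerEigenspace hq] at h2
      rw [show μ = μ - (1 + formShift q) + 1 + formShift q by ring, ← h2]
      refine Cardinal.mk_congr (Equiv.subtypeEquivRight fun k => ?_)
      constructor <;> intro h <;> linarith
    have h1 := sum_eigenvalues_le_trace hJ hB hs hd hmono hm (u := hermiteTrial)
      orthonormal_emb_hermiteTrial n
    simp_rw [schrodingerForm_hermiteTrial hq] at h1
    -- The sums with `∫ q` are separated on both sides and cancel; so do the `n + 1` copies of the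
    -- shift in `h1`.
    rw [Finset.sum_sub_distrib, Finset.sum_sub_distrib, Finset.sum_sub_distrib,
      ← sum_integral_mul_hermiteFn_sq hq n]
    simp only [Finset.sum_add_distrib] at h1
    linarith
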